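/- **Setting.** Fix $N\ge 0$. An off-shell worldline supermultiplet of $N$-extended supersymmetry without central charge, with finitely many component fields, consists of finitely many real bosons $\phi_a$ and real fermions $\psi_\alpha$, a basis of a free $\mathbb{R}[\partial]$-module ($\partial=d/d\tau$; no differential equations are imposed), together with transformation rules $$Q_I\phi_a=\sum_\alpha (L_I)_{a\alpha}(\partial)\,\psi_\alpha,\qquad Q_I\psi_\alpha=i\sum_a (R_I)_{\alpha a}(\partial)\,\phi_a\qquad(I=1,\dots,N),$$ with $L_I,R_I$ matrices over $\mathbb{R}[\partial]$, such that $\{Q_I,Q_J\}=2i\,\delta_{IJ}\,\partial$ holds identically. It is *engineerable* if each component field $F$ can be given an engineering dimension $[F]\in\mathbb{R}$ such that, with $[\partial]=1$, every $Q_I F$ is homogeneous of dimension $[F]+\frac12$; fix such an assignment. * A *valise* is such a supermultiplet in which all bosons have one dimension $m$ and all fermions have one dimension, $m+\frac12$ or $m-\frac12$. * An *Adinkra* is identified with the supermultiplet it depicts: each $Q_I$ pairs bosons with fermions so that on each pair $Q_I\phi_a=\pm\partial^{e}\psi_\alpha$ and $Q_I\psi_\alpha=\pm i\,\partial^{1-e}\phi_a$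 with $e\in\{0,1\}$ and the same sign in both; its nodes are the component fields. It is *minimal* if it is nonzero and has the least number of component fields among all nonzero supermultiplets with the given $N$. * *Lowering* a real linear combination $\ell=\sum_A c_AF_A$ of component fields of one statistics and one engineering dimension is allowed if for each $I$, $Q_I\ell=\partial f_I$ is a total derivative. One chooses some $F_{A_0}$ with $c_{A_0}\neq0$ and replaces it by $\Lambda=\int\! d\tau\,\ell$, with $Q_I\Lambda=f_I$ and $[\Lambda]=[\ell]-1$; in all other transformation rules $F_{A_0}$ is expressed as $c_{A_0}^{-1}\big(\partial\Lambda-\sum_{A\ne A_0}c_AF_A\big)$. * Two supermultiplets are *equivalent by local field redefinitions* if there are invertible matrices over $\mathbb{R}[\partial]$ (with inverses over $\mathbb{R}[\partial]$), one for the bosons and one for the fermions, homogeneous with respect to the engineering dimensions, that carry the fields and transformation rules of one into those of the other. **Theorem (adinkraic analysis/synthesis).** For every $N$, every engineerable off-shell worldline supermultiplet of $N$-extended supersymmetry without central charge, with finitely many component fields and any consistent assignment of engineering dimensions, is equivalent by local field redefinitions to a supermultiplet obtained from a finite direct sum of minimal valise Adinkras by finitely many successive lowerings of linear combinations of component fields.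 -/

import Mathlib

namespace Worldline

open Polynomial

universe u v w

/-- An off-shell supermultiplet of `N`-extended worldline supersymmetry without central charge,
presented in a finite basis of real component fields: bosons `φ a` (`a : B`) and fermions
`ψ α` (`α : F`).  The indeterminate `X` of `ℝ[X]` is the time derivative `∂`, and the fields
together with their derivatives are linearly independent (off-shell: no differential equations),
so the supermultiplet is a free module over `ℝ[∂]`.  The matrices encode

  `Q_I (φ a) = ∑ α, (L I a α)(∂) (ψ α)`,  `Q_I (ψ α) = i ∑ a, (R I α a)(∂) (φ a)`,

and `susy_boson`, `susy_fermion` are `{Q_I, Q_J} = 2 i δ_IJ ∂` on bosons and on fermions, with the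
common factor `i` removed (see `charge_anticomm`). -/
structure Supermultiplet (N : ℕ) (B : Type u) (F : Type v)
    [Fintype B] [DecidableEq B] [Fintype F] [DecidableEq F] where
  L : Fin N → Matrix B F ℝ[X]
  R : Fin N → Matrix F B ℝ[X]
  susy_boson : ∀ I J : Fin N,
    L I * R J + L J * R I = (if I = J then 2 * X else 0 : ℝ[X]) • (1 : Matrix B B ℝ[X])
  susy_fermion : ∀ I J : Fin N,
    R I * L J + R J * L I = (if I = J then 2 * X else 0 : ℝ[X]) • (1 : Matrix F F ℝ[X])

section Charge

variable {N : ℕ} {B : Type u} {F : Type v}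
  [Fintype B] [DecidableEq B] [Fintype F] [DecidableEq F]

/-- The matrix over `ℂ[∂]` of the supercharge `Q_I` acting on all component fields. -/
noncomputable def Supermultiplet.charge (M : Supermultiplet N B F) (I : Fin N) :
    Matrix (B ⊕ F) (B ⊕ F) ℂ[X] :=
  Matrix.fromBlocks 0 ((M.L I).map (mapRingHom Complex.ofRealHom))
    ((C Complex.I : ℂ[X]) • (M.R I).map (mapRingHom Complex.ofRealHom)) 0

/-- The supersymmetry algebra `{Q_I, Q_J} = 2 i δ_IJ ∂`. -/
theorem Supermultiplet.charge_anticomm (M : Supermultiplet N B F) (I J : Fin N) :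
    M.charge I * M.charge J + M.charge J * M.charge I =
      (if I = J then C (2 * Complex.I) * X else 0 : ℂ[X]) •
        (1 : Matrix (B ⊕ F) (B ⊕ F) ℂ[X]) := by
  have hB := congrArg (fun A => A.map (mapRingHom Complex.ofRealHom)) (M.susy_boson I J)
  have hF := congrArg (fun A => A.map (mapRingHom Complex.ofRealHom)) (M.susy_fermion I J)
  simp only [Matrix.map_add _ (map_add _), Matrix.map_mul] at hB hF
  unfold Supermultiplet.charge
  simp only [Matrix.fromBlocks_multiply, Matrix.fromBlocks_add, Matrix.mul_smul,
    Matrix.smul_mul, Matrix.zero_mul, Matrix.mul_zero, zero_add, add_zero, ← smul_add, hB, hF,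
    smul_zero]
  rw [← Matrix.fromBlocks_one, Matrix.fromBlocks_smul]
  have h2 : (C (2 : ℂ) : ℂ[X]) = 2 := map_ofNat C 2
  congr 1
  · ext1 a b
    by_cases h : I = J <;> by_cases hab : a = b <;> simp [h, hab, Matrix.map_apply, h2]
    ring
  · simp
  · simp
  · ext1 a b
    by_cases h : I = J <;> by_cases hab : a = b <;> simp [h, hab, Matrix.map_apply, h2]
    ring

end Charge

/-- A supermultiplet with a consistent assignment of engineering dimensions to its component
fields.  As `[Q_I] = 1/2` and `[∂] = 1`, a term `∂ ^ n ψ` of `Q_I φ` has `[φ] + 1/2 = [ψ] + n`,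
and likewise with bosons and fermions interchanged.  A supermultiplet is engineerable if and only
if it admits such an assignment. -/
structure EngSupermultiplet (N : ℕ) (B : Type u) (F : Type v)
    [Fintype B] [DecidableEq B] [Fintype F] [DecidableEq F] extends Supermultiplet N B F where
  dimB : B → ℝ
  dimF : F → ℝ
  homog_L : ∀ (I : Fin N) (a : B) (α : F) (n : ℕ),
    (L I a α).coeff n ≠ 0 → dimB a + 1 / 2 = dimF α + n
  homog_R : ∀ (I : Fin N) (α : F) (a : B) (n : ℕ),
    (R I α a).coeff n ≠ 0 → dimF α + 1 / 2 = dimB a + n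

section Basic

variable {N : ℕ} {B : Type u} {F : Type v}
  [Fintype B] [DecidableEq B] [Fintype F] [DecidableEq F]

/-- An Adinkra, identified with the supermultiplet it depicts: each `Q_I` pairs the bosons with
the fermions, and on such a pair (an edge of colour `I` joining the nodes `φ a` and `ψ α`)
`Q_I (φ a) = ± ∂ ^ e (ψ α)` and `Q_I (ψ α) = ± i ∂ ^ (1 - e) (φ a)` with `e = 0` or `e = 1`,
the sign `s` recording whether the edge is solid or dashed. -/
def Supermultiplet.IsAdinkra (M : Supermultiplet N B F) : Prop :=
  let Edge (I : Fin N) (a : B) (α : F) : Prop :=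
    ∃ s : ℝ, (s = 1 ∨ s = -1) ∧ ∃ e : ℕ, e ≤ 1 ∧
      M.L I a = Pi.single α (C s * X ^ e) ∧ M.R I α = Pi.single a (C s * X ^ (1 - e))
  ∀ I : Fin N, (∀ a : B, ∃ α : F, Edge I a α) ∧ (∀ α : F, ∃ a : B, Edge I a α)

/-- A valise: one engineering dimension for all bosons and one for all fermions, differing
by `1/2` (in either direction). -/
def EngSupermultiplet.IsValise (M : EngSupermultiplet N B F) : Prop :=
  ∃ m : ℝ, (∀ a : B, M.dimB a = m) ∧
    ((∀ α : F, M.dimF α = m + 1 / 2) ∨ (∀ α : F, M.dimF α = m - 1 / 2))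

/-- Nonzero, and with the least number of component fields possible for the given `N`. -/
def Supermultiplet.IsMinimal (_M : Supermultiplet N B F) : Prop :=
  0 < Fintype.card B + Fintype.card F ∧
    ∀ (b f : ℕ), Supermultiplet N (Fin b) (Fin f) → 0 < b + f →
      Fintype.card B + Fintype.card F ≤ b + f

/-- A minimal valise Adinkra. -/
def EngSupermultiplet.IsMinimalValiseAdinkra (M : EngSupermultiplet N B F) : Prop :=
  M.IsAdinkra ∧ M.IsValise ∧ M.IsMinimal

end Basic

section DirectSum

variable {N : ℕ} {ι : Type w} [Fintype ι] [DecidableEq ι] {B : ι → Type u} {F : ι → Type v}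
  [∀ i, Fintype (B i)] [∀ i, DecidableEq (B i)] [∀ i, Fintype (F i)] [∀ i, DecidableEq (F i)]

/-- The direct sum of a finite family of supermultiplets: its component fields are those of all
the summands, with their transformation rules and engineering dimensions. -/
noncomputable def directSum (A : ∀ i, EngSupermultiplet N (B i) (F i)) :
    EngSupermultiplet N (Σ i, B i) (Σ i, F i) where
  L I := Matrix.blockDiagonal' fun i => (A i).L I
  R I := Matrix.blockDiagonal' fun i => (A i).R I
  susy_boson I J := by
    rw [← Matrix.blockDiagonal'_mul, ← Matrix.blockDiagonal'_mul, ← Matrix.blockDiagonal'_add,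
      ← Matrix.blockDiagonal'_one, ← Matrix.blockDiagonal'_smul]
    exact congrArg _ (funext fun i => (A i).susy_boson I J)
  susy_fermion I J := by
    rw [← Matrix.blockDiagonal'_mul, ← Matrix.blockDiagonal'_mul, ← Matrix.blockDiagonal'_add,
      ← Matrix.blockDiagonal'_one, ← Matrix.blockDiagonal'_smul]
    exact congrArg _ (funext fun i => (A i).susy_fermion I J)
  dimB x := (A x.1).dimB x.2
  dimF x := (A x.1).dimF x.2
  homog_L := by
    rintro I ⟨i, a⟩ ⟨j, α⟩ n h
    by_cases hij : i = j
    · subst hij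
      rw [Matrix.blockDiagonal'_apply_eq] at h
      exact (A i).homog_L I a α n h
    · rw [Matrix.blockDiagonal'_apply_ne _ _ _ hij] at h
      simp at h
  homog_R := by
    rintro I ⟨i, α⟩ ⟨j, a⟩ n h
    by_cases hij : i = j
    · subst hij
      rw [Matrix.blockDiagonal'_apply_eq] at h
      exact (A i).homog_R I α a n h
    · rw [Matrix.blockDiagonal'_apply_ne _ _ _ hij] at h
      simp at h

end DirectSum

/-- Effect of lowering `ℓ = ∑ k, c k • x k`, where the field `x k₀` is replaced by `∫ ℓ`, on the
transformation rules.  Here `x k` (`k : κ`) are the fields of one statistics, `y j` (`j : μ`)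
those of the other one, and `P` and `S` (before) and `P'` and `S'` (after) are the matrices of one
supercharge from the `x` to the `y` and from the `y` to the `x`.
* The rules of the other fields `x k` do not change.
* `Q (ℓ)` is a total derivative `∂ f`, and `Q (∫ ℓ) = f`; the matrix `P'` holds `f` in row `k₀`.
* In the rules of the `y j` one substitutes `x k₀ = (c k₀)⁻¹ (∂ (∫ ℓ) - ∑ k ≠ k₀, c k • x k)`. -/
def LowersRules {κ : Type u} {μ : Type v} [Fintype κ] (c : κ → ℝ) (k₀ : κ)
    (P P' : Matrix κ μ ℝ[X]) (S S' : Matrix μ κ ℝ[X]) : Prop :=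
  (∀ k, k ≠ k₀ → P' k = P k) ∧
  (∀ j, X * P' k₀ j = ∑ k, C (c k) * P k j) ∧
  (∀ j, S' j k₀ = C (c k₀)⁻¹ * X * S j k₀) ∧
  (∀ j, ∀ k, k ≠ k₀ → S' j k = S j k - C (c k / c k₀) * S j k₀)

section Lowering

variable {N : ℕ} {B : Type u} {F : Type v}
  [Fintype B] [DecidableEq B] [Fintype F] [DecidableEq F]

/-- `M'` arises from `M` by lowering the real linear combination `∑ a, c a • φ a` of bosons of
one engineering dimension, the boson `φ a₀` (with `c a₀ ≠ 0`) being replaced by its integral. -/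
def LowersBoson (M M' : EngSupermultiplet N B F) : Prop :=
  ∃ (c : B → ℝ) (a₀ : B), c a₀ ≠ 0 ∧ (∀ a, c a ≠ 0 → M.dimB a = M.dimB a₀) ∧
    M'.dimB = Function.update M.dimB a₀ (M.dimB a₀ - 1) ∧ M'.dimF = M.dimF ∧
    ∀ I, LowersRules c a₀ (M.L I) (M'.L I) (M.R I) (M'.R I)

/-- `M'` arises from `M` by lowering the real linear combination `∑ α, c α • ψ α` of fermions of
one engineering dimension, the fermion `ψ α₀` (with `c α₀ ≠ 0`) being replaced by its integral. -/
def LowersFermion (M M' : EngSupermultiplet N B F) : Prop :=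
  ∃ (c : F → ℝ) (α₀ : F), c α₀ ≠ 0 ∧ (∀ α, c α ≠ 0 → M.dimF α = M.dimF α₀) ∧
    M'.dimF = Function.update M.dimF α₀ (M.dimF α₀ - 1) ∧ M'.dimB = M.dimB ∧
    ∀ I, LowersRules c α₀ (M.R I) (M'.R I) (M.L I) (M'.L I)

/-- `M'` arises from `M` by lowering one linear combination of component fields. -/
def Lowers (M M' : EngSupermultiplet N B F) : Prop :=
  LowersBoson M M' ∨ LowersFermion M M'

end Lowering

/-- Equivalence by a local field redefinition respecting engineering dimensions: the fields of `M`
are `φ a = ∑ b, (U a b)(∂) (φ' b)` and `ψ α = ∑ β, (V α β)(∂) (ψ' β)` in terms of those of `M'`,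
conversely those of `M'` are local expressions in those of `M`, and the transformation rules
correspond. -/
def LocallyEquivalent {N : ℕ} {B : Type u} {F : Type v} {B' : Type w} {F' : Type*}
    [Fintype B] [DecidableEq B] [Fintype F] [DecidableEq F]
    [Fintype B'] [DecidableEq B'] [Fintype F'] [DecidableEq F']
    (M : EngSupermultiplet N B F) (M' : EngSupermultiplet N B' F') : Prop :=
  ∃ (U : Matrix B B' ℝ[X]) (U' : Matrix B' B ℝ[X])
    (V : Matrix F F' ℝ[X]) (V' : Matrix F' F ℝ[X]),
    U * U' = 1 ∧ U' * U = 1 ∧ V * V' = 1 ∧ V' * V = 1 ∧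
    (∀ I, M.L I * V = U * M'.L I) ∧ (∀ I, M.R I * U = V * M'.R I) ∧
    (∀ a b n, (U a b).coeff n ≠ 0 → M.dimB a = M'.dimB b + n) ∧
    (∀ b a n, (U' b a).coeff n ≠ 0 → M'.dimB b = M.dimB a + n) ∧
    (∀ α β n, (V α β).coeff n ≠ 0 → M.dimF α = M'.dimF β + n) ∧
    (∀ β α n, (V' β α).coeff n ≠ 0 → M'.dimF β = M.dimF α + n)

end Worldline

/-! Fix `T` above all engineering dimensions. A field of least dimension, if below `T - 1`, can be
replaced by its derivative: no field lies `1/2` below it, so the other rules contain it only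
differentiated (`exists_raise`). After finitely many such raisings all dimensions lie in `[T - 1,
T)`. Each raising is undone, up to equivalence, by lowering one linear combination
(`exists_lowersBoson_of_raise`), so it remains to show that a supermultiplet with dimensions in `[T
- 1, T)` is equivalent to a direct sum of minimal valise Adinkras.

In such a window every entry of the rules is a monomial whose exponent is fixed by the dimensions,
so setting `∂ = 1` loses nothing. There the supercharges (without `i`) and the fermion parity become
anticommuting involutions: a real representation of a finite Clifford group `G` on `N + 1`
generators, with central sign acting as `-1`. It carries an invariant inner product.

Let `H` be a maximal subgroup of exponent two containing the parity, and `v` a common eigenvector of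
`H`. For `g ∉ H` the vectors `g v` and `v` are orthogonal (`IsPrimitive.orthogonal`): either `g`
commutes with `H`, whence `g² = sgn` by maximality and `g` acts skewly, or `g` anticommutes with
some `h ∈ H`, which then has opposite eigenvalues on them. So the orbit of `v` is, up to signs, an
orthogonal basis indexed by `G ⧸ H`, which the generators permute up to sign. Splitting off orbits
one at a time (`exists_orbit_basis`), with all vectors homogeneous, yields Adinkras with one bosonic
and one fermionic dimension.

Every orbit has `|G ⧸ H|` elements and `H` depends only on `N`; hence every nonzero supermultiplet
has at least that many fields (`card_quotient_le`), and the summands are minimal. -/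

namespace Worldline

open Polynomial Matrix

/-! ### Homogeneous matrices and cancellation over a domain -/

section Homogeneous

variable {A A' A'' : Type*}

/-- A matrix over `ℝ[∂]` is homogeneous of degree `s` with respect to dimensions `d` and `e`. -/
def HomogMatrix (d : A → ℝ) (e : A' → ℝ) (s : ℝ) (U : Matrix A A' ℝ[X]) : Prop :=
  ∀ a b n, (U a b).coeff n ≠ 0 → d a + s = e b + n

theorem HomogMatrix.mul [Fintype A'] {d : A → ℝ} {e : A' → ℝ} {f : A'' → ℝ} {s t : ℝ}
    {U : Matrix A A' ℝ[X]} {V : Matrix A' A'' ℝ[X]} (hU : HomogMatrix d e s U)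
    (hV : HomogMatrix e f t V) : HomogMatrix d f (s + t) (U * V) := by
  intro a b n h
  rw [Matrix.mul_apply, finsetSum_coeff] at h
  obtain ⟨k, -, hk⟩ := Finset.exists_ne_zero_of_sum_ne_zero h
  rw [coeff_mul] at hk
  obtain ⟨⟨i, j⟩, hij, hne⟩ := Finset.exists_ne_zero_of_sum_ne_zero hk
  have h1 := hU a k i (left_ne_zero_of_mul hne)
  have h2 := hV k b j (right_ne_zero_of_mul hne)
  rw [Finset.HasAntidiagonal.mem_antidiagonal] at hij
  have h3 : (i : ℝ) + j = n := by exact_mod_cast hij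
  linarith

end Homogeneous

section Cancel

variable {A A' R : Type*} [Fintype A] [DecidableEq A] [CommRing R] [IsDomain R]

theorem mul_left_cancel_of_det_ne_zero {D : Matrix A A R} (hD : D.det ≠ 0)
    {P Q : Matrix A A' R} (h : D * P = D * Q) : P = Q := by
  have h2 := congrArg (D.adjugate * ·) h
  simp only [← Matrix.mul_assoc, adjugate_mul, Matrix.smul_mul, Matrix.one_mul] at h2
  ext i j
  exact mul_left_cancel₀ hD (congrFun (congrFun h2 i) j)

theorem mul_right_cancel_of_det_ne_zero {D : Matrix A A R} (hD : D.det ≠ 0)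
    {P Q : Matrix A' A R} (h : P * D = Q * D) : P = Q := by
  have h2 := congrArg (· * D.adjugate) h
  simp only [Matrix.mul_assoc, mul_adjugate, Matrix.mul_smul, Matrix.mul_one] at h2
  ext i j
  exact mul_left_cancel₀ hD (congrFun (congrFun h2 i) j)

end Cancel

/-! ### The algebra under changes of frame, and local equivalence -/

section Basic

variable {N : ℕ} {B F B' F' : Type*}
  [Fintype B] [DecidableEq B] [Fintype F] [DecidableEq F]
  [Fintype B'] [DecidableEq B'] [Fintype F'] [DecidableEq F']

theorem Supermultiplet.L_mul_R (M : Supermultiplet N B F) (I : Fin N) :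
    M.L I * M.R I = (X : ℝ[X]) • (1 : Matrix B B ℝ[X]) := by
  have h := M.susy_boson I I
  rw [if_pos rfl, ← two_smul ℝ[X], mul_smul] at h
  ext1 a b
  exact mul_left_cancel₀ two_ne_zero (congrFun (congrFun h a) b)

theorem Supermultiplet.R_mul_L (M : Supermultiplet N B F) (I : Fin N) :
    M.R I * M.L I = (X : ℝ[X]) • (1 : Matrix F F ℝ[X]) := by
  have h := M.susy_fermion I I
  rw [if_pos rfl, ← two_smul ℝ[X], mul_smul] at h
  ext1 a b
  exact mul_left_cancel₀ two_ne_zero (congrFun (congrFun h a) b)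

/-- If the rules of the bosons correspond, so do those of the fermions. -/
theorem Supermultiplet.R_mul_eq_of_L_mul_eq (M : Supermultiplet N B F)
    (M' : Supermultiplet N B' F') {U : Matrix B B' ℝ[X]} {V : Matrix F F' ℝ[X]} {I : Fin N}
    (h : M.L I * V = U * M'.L I) : M.R I * U = V * M'.R I := by
  have h2 : (X : ℝ[X]) • (V * M'.R I) = (X : ℝ[X]) • (M.R I * U) := by
    calc (X : ℝ[X]) • (V * M'.R I) = (M.R I * M.L I) * (V * M'.R I) := by
          rw [M.R_mul_L, Matrix.smul_mul, Matrix.one_mul]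
      _ = M.R I * ((M.L I * V) * M'.R I) := by simp only [Matrix.mul_assoc]
      _ = M.R I * (U * (M'.L I * M'.R I)) := by rw [h, Matrix.mul_assoc]
      _ = _ := by rw [M'.L_mul_R, Matrix.mul_smul, Matrix.mul_one, Matrix.mul_smul]
  ext1 a b
  exact (mul_left_cancel₀ X_ne_zero (congrFun (congrFun h2 a) b)).symm

/-- Exchange of bosons and fermions. -/
def EngSupermultiplet.swap (M : EngSupermultiplet N B F) : EngSupermultiplet N F B where
  L := M.R
  R := M.L
  susy_boson := M.susy_fermion
  susy_fermion := M.susy_boson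
  dimB := M.dimF
  dimF := M.dimB
  homog_L := M.homog_R
  homog_R := M.homog_L

theorem LocallyEquivalent.swap {M : EngSupermultiplet N B F} {M' : EngSupermultiplet N B' F'}
    (h : LocallyEquivalent M M') : LocallyEquivalent M.swap M'.swap := by
  obtain ⟨U, U', V, V', h1, h2, h3, h4, h5, h6, h7, h8, h9, h10⟩ := h
  exact ⟨V, V', U, U', h3, h4, h1, h2, h6, h5, h9, h10, h7, h8⟩

theorem LocallyEquivalent.symm {M : EngSupermultiplet N B F} {M' : EngSupermultiplet N B' F'}
    (h : LocallyEquivalent M M') : LocallyEquivalent M' M := by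
  obtain ⟨U, U', V, V', h1, h2, h3, h4, h5, h6, h7, h8, h9, h10⟩ := h
  have hL : ∀ I, M'.L I * V' = U' * M.L I := by
    intro I
    calc M'.L I * V' = (U' * U) * M'.L I * V' := by rw [h2, Matrix.one_mul]
      _ = U' * (U * M'.L I) * V' := by simp only [Matrix.mul_assoc]
      _ = U' * M.L I * (V * V') := by rw [← h5]; simp only [Matrix.mul_assoc]
      _ = _ := by rw [h3, Matrix.mul_one]
  exact ⟨U', U, V', V, h2, h1, h4, h3, hL,
    fun I => M'.toSupermultiplet.R_mul_eq_of_L_mul_eq M.toSupermultiplet (hL I),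
    h8, h7, h10, h9⟩

/-- The supersymmetry algebra passes to a frame of bosons that generates a bigger module. -/
theorem susy_of_frame (M : Supermultiplet N B F) {E : Matrix B B ℝ[X]} (hE : E.det ≠ 0)
    {L : Fin N → Matrix B F ℝ[X]} {R : Fin N → Matrix F B ℝ[X]}
    (hL : ∀ I, E * L I = M.L I) (hR : ∀ I, R I = M.R I * E) (I J : Fin N) :
    L I * R J + L J * R I = (if I = J then 2 * X else 0 : ℝ[X]) • (1 : Matrix B B ℝ[X]) ∧
    R I * L J + R J * L I = (if I = J then 2 * X else 0 : ℝ[X]) • (1 : Matrix F F ℝ[X]) := by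
  constructor
  · apply mul_left_cancel_of_det_ne_zero hE
    calc E * (L I * R J + L J * R I) = (M.L I * M.R J + M.L J * M.R I) * E := by
          simp only [Matrix.mul_add, Matrix.add_mul, ← Matrix.mul_assoc, hL]
          simp only [hR, Matrix.mul_assoc]
      _ = _ := by rw [M.susy_boson, Matrix.smul_mul, Matrix.mul_smul, Matrix.one_mul,
                    Matrix.mul_one]
  · rw [hR, hR, Matrix.mul_assoc, Matrix.mul_assoc, hL, hL, M.susy_fermion]

/-- The supersymmetry algebra passes to a frame of bosons that generates a smaller module. -/
theorem susy_of_subframe (M : Supermultiplet N B F) {E : Matrix B B ℝ[X]} (hE : E.det ≠ 0)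
    {L : Fin N → Matrix B F ℝ[X]} {R : Fin N → Matrix F B ℝ[X]}
    (hL : ∀ I, L I = E * M.L I) (hR : ∀ I, R I * E = M.R I) (I J : Fin N) :
    L I * R J + L J * R I = (if I = J then 2 * X else 0 : ℝ[X]) • (1 : Matrix B B ℝ[X]) ∧
    R I * L J + R J * L I = (if I = J then 2 * X else 0 : ℝ[X]) • (1 : Matrix F F ℝ[X]) := by
  constructor
  · apply mul_right_cancel_of_det_ne_zero hE
    calc (L I * R J + L J * R I) * E = E * (M.L I * M.R J + M.L J * M.R I) := by
          simp only [Matrix.mul_add, Matrix.add_mul, Matrix.mul_assoc, hR]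
          simp only [hL, Matrix.mul_assoc]
      _ = _ := by rw [M.susy_boson, Matrix.smul_mul, Matrix.mul_smul, Matrix.one_mul,
                    Matrix.mul_one]
  · rw [hL, hL, ← Matrix.mul_assoc, ← Matrix.mul_assoc, hR, hR, M.susy_fermion]

end Basic

/-! ### Lowering as a change of frame -/

section LoweringFrame

variable {A A' : Type*} [Fintype A] [DecidableEq A]

/-- The row by which the field `k₀` is expressed through the fields after lowering `∑ k, c k • x k`,
minus the unit row. -/
noncomputable def loweringRow (c : A → ℝ) (k₀ : A) (k : A) : ℝ[X] :=
  if k = k₀ then C (c k₀)⁻¹ * X - 1 else -C (c k / c k₀)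

/-- The matrix expressing the fields before lowering `∑ k, c k • x k` through those after. -/
noncomputable def loweringMatrix (c : A → ℝ) (k₀ : A) : Matrix A A ℝ[X] :=
  1 + vecMulVec (Pi.single k₀ 1) (loweringRow c k₀)

theorem mul_loweringMatrix_apply (c : A → ℝ) (k₀ : A) (S : Matrix A' A ℝ[X]) (j : A') (k : A) :
    (S * loweringMatrix c k₀) j k = S j k + S j k₀ * loweringRow c k₀ k := by
  simp [loweringMatrix, Matrix.mul_add, mul_vecMulVec, vecMulVec_apply]

theorem loweringMatrix_mul_apply (c : A → ℝ) (k₀ : A) (P : Matrix A A' ℝ[X]) (k : A) (j : A') :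
    (loweringMatrix c k₀ * P) k j =
      P k j + (Pi.single k₀ 1 : A → ℝ[X]) k * ∑ i, loweringRow c k₀ i * P i j := by
  simp [loweringMatrix, Matrix.add_mul, vecMulVec_mul, vecMulVec_apply, vecMul, dotProduct]

/-- A rank-one perturbation of the identity, so the matrix determinant lemma applies; the new frame
generates a strictly larger module, and identities can still be cancelled. -/
theorem det_loweringMatrix {c : A → ℝ} {k₀ : A} (hc : c k₀ ≠ 0) :
    (loweringMatrix c k₀).det ≠ 0 := by
  have h : (loweringMatrix c k₀).det = C (c k₀)⁻¹ * X := by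
    rw [loweringMatrix, vecMulVec_eq Unit,
      det_one_add_replicateCol_mul_replicateRow]
    simp [loweringRow]
  rw [h]
  exact mul_ne_zero (C_ne_zero.2 (inv_ne_zero hc)) X_ne_zero

theorem homog_loweringMatrix {c : A → ℝ} {k₀ : A} {d : A → ℝ}
    (hd : ∀ k, c k ≠ 0 → d k = d k₀) :
    HomogMatrix d (Function.update d k₀ (d k₀ - 1)) 0 (loweringMatrix c k₀) := by
  intro a b n h
  have e : loweringMatrix c k₀ a b =
      (1 : Matrix A A ℝ[X]) a b + (1 : Matrix A A ℝ[X]) a k₀ * loweringRow c k₀ b := by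
    rw [← mul_loweringMatrix_apply, Matrix.one_mul]
  rw [e] at h
  by_cases ha : a = k₀
  · subst ha
    by_cases hb : b = a
    · subst hb
      simp only [one_apply_eq, loweringRow, if_true, one_mul, add_sub_cancel, coeff_C_mul,
        coeff_X] at h
      have hn : 1 = n := by
        by_contra hn
        simp [hn] at h
      subst hn
      simp
    · simp only [one_apply_ne (Ne.symm hb), loweringRow, if_neg hb, one_apply_eq, one_mul,
        zero_add, coeff_neg, coeff_C] at h
      have hn : n = 0 := by
        by_contra hn
        simp [hn] at h
      subst hn
      have : c b ≠ 0 := by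
        intro h0
        simp [h0] at h
      simp [Function.update_of_ne hb, hd b this]
  · rw [one_apply_ne ha, zero_mul, add_zero] at h
    by_cases hb : a = b
    · subst hb
      rw [one_apply_eq, coeff_one] at h
      have hn : n = 0 := by
        by_contra hn
        simp [hn] at h
      simp [hn, Function.update_of_ne ha]
    · simp [one_apply_ne hb] at h

/-- The rows of the fields after lowering, when `∑ k, c k • x k` is a total derivative. -/
noncomputable def lowerRows (c : A → ℝ) (k₀ : A) (P : Matrix A A' ℝ[X]) : Matrix A A' ℝ[X] :=
  fun k j => if k = k₀ then divX (∑ i, C (c i) * P i j) else P k j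

theorem X_mul_lowerRows {c : A → ℝ} {k₀ : A} {P : Matrix A A' ℝ[X]}
    (h : ∀ j, (∑ i, C (c i) * P i j).coeff 0 = 0) (j : A') :
    X * lowerRows c k₀ P k₀ j = ∑ i, C (c i) * P i j := by
  have h2 := X_mul_divX_add (∑ i, C (c i) * P i j)
  rw [h, C_0, add_zero] at h2
  simpa [lowerRows] using h2

theorem loweringMatrix_mul_lowerRows {c : A → ℝ} {k₀ : A} (hc : c k₀ ≠ 0)
    {P : Matrix A A' ℝ[X]} (h : ∀ j, (∑ i, C (c i) * P i j).coeff 0 = 0) :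
    loweringMatrix c k₀ * lowerRows c k₀ P = P := by
  ext1 k j
  rw [loweringMatrix_mul_apply]
  by_cases hk : k = k₀
  · subst hk
    have hX := X_mul_lowerRows (k₀ := k) h j
    rw [← Finset.add_sum_erase _ _ (Finset.mem_univ k)] at hX ⊢
    have e : ∑ i ∈ Finset.univ.erase k, loweringRow c k i * lowerRows c k P i j =
        - (C (c k)⁻¹ * ∑ i ∈ Finset.univ.erase k, C (c i) * P i j) := by
      rw [Finset.mul_sum, ← Finset.sum_neg_distrib]
      refine Finset.sum_congr rfl fun i hi => ?_
      have hi := Finset.ne_of_mem_erase hi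
      simp only [loweringRow, if_neg hi, lowerRows, div_eq_mul_inv, C_mul]
      ring
    have hcc : (C (c k)⁻¹ * C (c k) : ℝ[X]) = 1 := by
      rw [← C_mul, inv_mul_cancel₀ hc, C_1]
    rw [e, Pi.single_eq_same, loweringRow, if_pos rfl]
    linear_combination C (c k)⁻¹ * hX + P k j * hcc
  · simp [lowerRows, hk]

theorem homog_lowerRows {c : A → ℝ} {k₀ : A} {d : A → ℝ} {e : A' → ℝ} {s : ℝ}
    (hd : ∀ k, c k ≠ 0 → d k = d k₀) {P : Matrix A A' ℝ[X]} (hP : HomogMatrix d e s P) :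
    HomogMatrix (Function.update d k₀ (d k₀ - 1)) e s (lowerRows c k₀ P) := by
  intro k j n h
  by_cases hk : k = k₀
  · subst hk
    simp only [lowerRows, if_true, coeff_divX, finsetSum_coeff, coeff_C_mul] at h
    obtain ⟨i, -, hi⟩ := Finset.exists_ne_zero_of_sum_ne_zero h
    have h1 := hP i j _ (right_ne_zero_of_mul hi)
    rw [hd i (left_ne_zero_of_mul hi)] at h1
    push_cast at h1
    rw [Function.update_self]
    linarith
  · simp only [lowerRows, if_neg hk] at h
    rw [Function.update_of_ne hk]
    exact hP k j n h

end LoweringFrame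

/-! ### Raising a field, and its inversion by lowering -/

section Raising

variable {B : Type*} [DecidableEq B]

/-- The diagonal matrix of the substitution of `∂ (φ a₀)` for `φ a₀`. -/
noncomputable def raisingMatrix (a₀ : B) : Matrix B B ℝ[X] :=
  diagonal fun a => if a = a₀ then X else 1

theorem homog_raisingMatrix (d : B → ℝ) (a₀ : B) :
    HomogMatrix (Function.update d a₀ (d a₀ + 1)) d 0 (raisingMatrix a₀) := by
  intro a b n h
  by_cases hab : a = b
  · subst hab
    rw [raisingMatrix, diagonal_apply_eq] at h
    by_cases ha : a = a₀
    · subst ha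
      rw [if_pos rfl, coeff_X] at h
      have hn : 1 = n := by
        by_contra hn
        simp [hn] at h
      simp [← hn]
    · rw [if_neg ha, coeff_one] at h
      have hn : n = 0 := by
        by_contra hn
        simp [hn] at h
      simp [hn, Function.update_of_ne ha]
  · simp [raisingMatrix, diagonal_apply_ne _ hab] at h

variable [Fintype B]

theorem raisingMatrix_mul_apply {F : Type*} (a₀ : B) (P : Matrix B F ℝ[X]) (a : B) (j : F) :
    (raisingMatrix a₀ * P) a j = (if a = a₀ then X else 1) * P a j := by
  rw [raisingMatrix, diagonal_mul]

theorem det_raisingMatrix (a₀ : B) : (raisingMatrix a₀).det ≠ 0 := by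
  rw [raisingMatrix, det_diagonal, Finset.prod_ne_zero_iff]
  intro a _
  split_ifs
  exacts [X_ne_zero, one_ne_zero]

variable {N : ℕ} {F : Type*} [Fintype F] [DecidableEq F]

/-- A boson no fermion of dimension lower by `1/2` transforms into can be replaced by its
derivative. -/
theorem EngSupermultiplet.exists_raise (M : EngSupermultiplet N B F) (a₀ : B)
    (h : ∀ α, M.dimF α + 1 / 2 ≠ M.dimB a₀) :
    ∃ M₁ : EngSupermultiplet N B F,
      M₁.dimB = Function.update M.dimB a₀ (M.dimB a₀ + 1) ∧ M₁.dimF = M.dimF ∧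
      ∀ I, M₁.L I = raisingMatrix a₀ * M.L I := by
  let R₁ : Fin N → Matrix F B ℝ[X] := fun I α a => if a = a₀ then divX (M.R I α a) else M.R I α a
  have hR : ∀ I, R₁ I * raisingMatrix a₀ = M.R I := by
    intro I
    ext1 α a
    rw [raisingMatrix, mul_diagonal]
    by_cases ha : a = a₀
    · subst ha
      -- An undifferentiated `φ a` in the rule of `ψ α` would force `ψ α` to lie `1/2` below it,
      -- which `h` excludes. Hence the column is divisible by `∂`.
      have h0 : (M.R I α a).coeff 0 = 0 := by
        by_contra h0
        exact h α (by simpa using M.homog_R I α a 0 h0)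
      have h2 := divX_mul_X_add (M.R I α a)
      rw [h0, C_0, add_zero] at h2
      simpa [R₁] using h2
    · simp [R₁, ha]
  have hs := susy_of_subframe M.toSupermultiplet (det_raisingMatrix a₀)
    (L := fun I => raisingMatrix a₀ * M.L I) (R := R₁) (fun _ => rfl) hR
  refine ⟨⟨⟨fun I => raisingMatrix a₀ * M.L I, R₁, fun I J => (hs I J).1, fun I J => (hs I J).2⟩,
    Function.update M.dimB a₀ (M.dimB a₀ + 1), M.dimF, ?_, ?_⟩, rfl, rfl, fun _ => rfl⟩
  · intro I
    have := (homog_raisingMatrix M.dimB a₀).mul (M.homog_L I)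
    rwa [zero_add] at this
  · intro I α a n hn
    by_cases ha : a = a₀
    · subst ha
      simp only [R₁, if_true, coeff_divX] at hn
      have := M.homog_R I α a _ hn
      push_cast at this
      rw [Function.update_self]
      linarith
    · simp only [R₁, if_neg ha] at hn
      rw [Function.update_of_ne ha]
      exact M.homog_R I α a n hn

variable {B' F' : Type*} [Fintype B'] [DecidableEq B'] [Fintype F'] [DecidableEq F']

theorem coeff_zero_mul_apply {A₁ A₂ A₃ : Type*} [Fintype A₂] (P : Matrix A₁ A₂ ℝ[X])
    (Q : Matrix A₂ A₃ ℝ[X]) (a : A₁) (b : A₃) :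
    ((P * Q) a b).coeff 0 = (∑ i, C ((P a i).coeff 0) * Q i b).coeff 0 := by
  simp [Matrix.mul_apply, finsetSum_coeff, mul_coeff_zero]

/-- If `M₁` arises from `M` by replacing a boson by its derivative, then a supermultiplet equivalent
to `M₁` can be lowered to one equivalent to `M`. -/
theorem exists_lowersBoson_of_raise {M M₁ : EngSupermultiplet N B F} {a₀ : B}
    {A₁ : EngSupermultiplet N B' F'}
    (hB : M₁.dimB = Function.update M.dimB a₀ (M.dimB a₀ + 1)) (hF : M₁.dimF = M.dimF)
    (hL : ∀ I, M₁.L I = raisingMatrix a₀ * M.L I) (h : LocallyEquivalent M₁ A₁) :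
    ∃ A₀ : EngSupermultiplet N B' F', LowersBoson A₁ A₀ ∧ LocallyEquivalent M A₀ := by
  -- The raised boson is `∑ b, c b • φ' b` plus a total derivative, in the fields `φ'` of `A₁`; this
  -- leading combination is the one to lower.
  obtain ⟨U, U', V, V', h1, h2, h3, h4, h5, h6, h7, h8, h9, h10⟩ := h
  set c : B' → ℝ := fun b => (U a₀ b).coeff 0 with hc
  -- `U` is invertible over `ℝ[∂]`, so its row `a₀` does not vanish at `∂ = 0`.
  obtain ⟨b₀, hb₀⟩ : ∃ b₀, c b₀ ≠ 0 := by
    by_contra! hcon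
    have e := coeff_zero_mul_apply U U' a₀ a₀
    rw [h1, one_apply_eq, coeff_one_zero] at e
    simp only [hc] at hcon
    simp [hcon] at e
  have hdim : ∀ b, c b ≠ 0 → A₁.dimB b = M₁.dimB a₀ := by
    intro b hb
    simpa using (h7 a₀ b 0 hb).symm
  have hd : ∀ b, c b ≠ 0 → A₁.dimB b = A₁.dimB b₀ := fun b hb => by rw [hdim b hb, hdim b₀ hb₀]
  have hU : HomogMatrix M₁.dimB A₁.dimB 0 U := fun a b n hn => by rw [add_zero]; exact h7 a b n hn
  have hU' : HomogMatrix A₁.dimB M₁.dimB 0 U' := fun a b n hn => by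
    rw [add_zero]; exact h8 a b n hn
  set E := loweringMatrix c b₀ with hE
  set D := raisingMatrix a₀ with hD
  have hEdet : E.det ≠ 0 := det_loweringMatrix hb₀
  have hDdet : D.det ≠ 0 := det_raisingMatrix a₀
  -- Modulo `∂`, the left side is row `a₀` of `U * A₁.L I = M₁.L I * V`, and row `a₀` of `M₁.L I` is
  -- `∂` times that of `M.L I`.
  have hdivL : ∀ I j, (∑ i, C (c i) * A₁.L I i j).coeff 0 = 0 := by
    intro I j
    rw [← coeff_zero_mul_apply, ← h5, hL, Matrix.mul_assoc, hD, raisingMatrix_mul_apply]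
    simp
  have hEL : ∀ I, E * lowerRows c b₀ (A₁.L I) = A₁.L I :=
    fun I => loweringMatrix_mul_lowerRows hb₀ (hdivL I)
  have hs := susy_of_frame A₁.toSupermultiplet hEdet hEL (R := fun I => A₁.R I * E) (fun _ => rfl)
  let A₀ : EngSupermultiplet N B' F' :=
    { L := fun I => lowerRows c b₀ (A₁.L I)
      R := fun I => A₁.R I * E
      susy_boson := fun I J => (hs I J).1
      susy_fermion := fun I J => (hs I J).2
      dimB := Function.update A₁.dimB b₀ (A₁.dimB b₀ - 1)
      dimF := A₁.dimF
      homog_L := fun I => homog_lowerRows hd (A₁.homog_L I)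
      homog_R := fun I => by
        have := HomogMatrix.mul (A₁.homog_R I) (homog_loweringMatrix hd)
        rwa [add_zero] at this }
  refine ⟨A₀, ⟨c, b₀, hb₀, hd, rfl, rfl, fun I => ⟨fun k hk => ?_, fun j => ?_, fun j => ?_,
    fun j k hk => ?_⟩⟩, ?_⟩
  · funext j
    simp [A₀, lowerRows, hk]
  · exact X_mul_lowerRows (hdivL I) j
  · change (A₁.R I * E) j b₀ = _
    rw [hE, mul_loweringMatrix_apply, loweringRow, if_pos rfl]
    ring
  · change (A₁.R I * E) j k = _
    rw [hE, mul_loweringMatrix_apply, loweringRow, if_neg hk]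
    ring
  -- At `∂ = 0` the lowered combination becomes a total derivative, so its coefficient row is
  -- annihilated. The new redefinition is then `D⁻¹ * U * E`, with inverse `E⁻¹ * U' * D`; both
  -- prove to be polynomial.
  have hUE0 : ∀ b, ((U * E) a₀ b).coeff 0 = 0 := by
    intro b
    rw [hE, mul_loweringMatrix_apply, loweringRow, coeff_add, mul_coeff_zero]
    change c b + c b₀ * _ = 0
    by_cases hb : b = b₀
    · subst hb
      simp
    · rw [if_neg hb, coeff_neg, coeff_C_zero]
      field_simp
      ring
  let U₀ : Matrix B B' ℝ[X] := fun a b => if a = a₀ then divX ((U * E) a b) else (U * E) a b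
  have hDU : D * U₀ = U * E := by
    ext1 a b
    rw [hD, raisingMatrix_mul_apply]
    by_cases ha : a = a₀
    · subst ha
      have := X_mul_divX_add ((U * E) a b)
      rw [hUE0, C_0, add_zero] at this
      simpa [U₀] using this
    · simp [U₀, ha]
  have hdivU : ∀ a, (∑ i, C (c i) * (U' * D) i a).coeff 0 = 0 := by
    intro a
    rw [← coeff_zero_mul_apply, ← Matrix.mul_assoc, h1, Matrix.one_mul, hD, raisingMatrix]
    by_cases ha : a₀ = a
    · subst ha; simp
    · simp [diagonal_apply_ne _ ha]
  have hEU : E * lowerRows c b₀ (U' * D) = U' * D := loweringMatrix_mul_lowerRows hb₀ hdivU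
  have hLV : ∀ I, M.L I * V = U₀ * A₀.L I := by
    intro I
    apply mul_left_cancel_of_det_ne_zero hDdet
    rw [← Matrix.mul_assoc, ← hL, h5, ← Matrix.mul_assoc, hDU, Matrix.mul_assoc, hEL]
  have hUE : HomogMatrix M₁.dimB A₀.dimB 0 (U * E) := by
    have := hU.mul (homog_loweringMatrix hd)
    rwa [add_zero] at this
  have hUD : HomogMatrix A₁.dimB M.dimB 0 (U' * D) := by
    rw [hB] at hU'
    have := hU'.mul (homog_raisingMatrix M.dimB a₀)
    rwa [add_zero] at this
  refine ⟨U₀, lowerRows c b₀ (U' * D), V, V', ?_, ?_, h3, h4, hLV,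
    fun I => M.toSupermultiplet.R_mul_eq_of_L_mul_eq A₀.toSupermultiplet (hLV I), ?_, ?_, ?_, ?_⟩
  · apply mul_left_cancel_of_det_ne_zero hDdet
    rw [← Matrix.mul_assoc, hDU, Matrix.mul_assoc, hEU, ← Matrix.mul_assoc, h1, Matrix.one_mul,
      Matrix.mul_one]
  · apply mul_left_cancel_of_det_ne_zero hEdet
    rw [← Matrix.mul_assoc, hEU, Matrix.mul_assoc, hDU, ← Matrix.mul_assoc, h2, Matrix.one_mul,
      Matrix.mul_one]
  · intro a b n hn
    by_cases ha : a = a₀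
    · subst ha
      simp only [U₀, if_true, coeff_divX] at hn
      have := hUE a b _ hn
      rw [hB, Function.update_self] at this
      push_cast at this
      linarith
    · simp only [U₀, if_neg ha] at hn
      have := hUE a b n hn
      rwa [hB, Function.update_of_ne ha, add_zero] at this
  · intro b a n hn
    have := homog_lowerRows hd hUD b a n hn
    rwa [add_zero] at this
  · rw [← hF]; exact h9
  · rw [← hF]; exact h10

end Raising

/-! ### The Clifford group and its maximal elementary abelian subgroups -/

section CliffordGroup

variable {ι : Type*}

/-- The relations of the Clifford group: the generator `none` is the central sign, the generators
`some i` are anticommuting involutions. -/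
def cliffordRels (ι : Type*) : Set (FreeGroup (Option ι)) :=
  {r | r = .of none * .of none ∨ (∃ i, r = .of (some i) * .of (some i)) ∨
    (∃ i, r = .of none * .of (some i) * (.of (some i) * .of none)⁻¹) ∨
    ∃ i j, i ≠ j ∧
      r = .of (some i) * .of (some j) * (.of none * (.of (some j) * .of (some i)))⁻¹}

/-- The Clifford group, generated by a central sign and anticommuting involutions. -/
abbrev CliffordGroup (ι : Type*) := PresentedGroup (cliffordRels ι)

namespace CliffordGroup

/-- The central sign of the Clifford group. -/
def sgn : CliffordGroup ι := PresentedGroup.of none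

/-- The anticommuting generators of the Clifford group. -/
def gen (i : ι) : CliffordGroup ι := PresentedGroup.of (some i)

theorem sgn_mul_sgn : (sgn : CliffordGroup ι) * sgn = 1 :=
  PresentedGroup.one_of_mem (Or.inl rfl)

theorem gen_mul_gen_self (i : ι) : gen i * gen i = 1 :=
  PresentedGroup.one_of_mem (Or.inr (Or.inl ⟨i, rfl⟩))

theorem sgn_mul_gen (i : ι) : sgn * gen i = gen i * sgn :=
  PresentedGroup.mk_eq_mk_of_mul_inv_mem (Or.inr (Or.inr (Or.inl ⟨i, rfl⟩)))

theorem gen_mul_gen {i j : ι} (h : i ≠ j) : gen i * gen j = sgn * (gen j * gen i) :=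
  PresentedGroup.mk_eq_mk_of_mul_inv_mem (Or.inr (Or.inr (Or.inr ⟨i, j, h, rfl⟩)))

theorem eq_top_of_gen_mem {H : Subgroup (CliffordGroup ι)} (hs : sgn ∈ H) (hg : ∀ i, gen i ∈ H)
    (g : CliffordGroup ι) : g ∈ H := by
  refine PresentedGroup.generated_by _ H ?_ g
  rintro (_ | i)
  exacts [hs, hg i]

theorem sgn_mul (g : CliffordGroup ι) : sgn * g = g * sgn := by
  have := eq_top_of_gen_mem (H := Subgroup.centralizer {sgn})
    (Subgroup.mem_centralizer_singleton_iff.2 rfl)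
    (fun i => Subgroup.mem_centralizer_singleton_iff.2 (sgn_mul_gen i).symm) g
  exact (Subgroup.mem_centralizer_singleton_iff.1 this).symm

/-- The elements that commute with `g` up to sign. -/
def signCentralizer (g : CliffordGroup ι) : Subgroup (CliffordGroup ι) where
  carrier := {h | h * g = g * h ∨ h * g = sgn * (g * h)}
  one_mem' := Or.inl (by simp)
  mul_mem' := by
    rintro a b (ha | ha) (hb | hb)
    · left; rw [mul_assoc, hb, ← mul_assoc, ha, mul_assoc]
    · right
      rw [mul_assoc, hb, ← mul_assoc, ← sgn_mul, mul_assoc, ← mul_assoc a, ha, mul_assoc]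
    · right; rw [mul_assoc, hb, ← mul_assoc, ha, mul_assoc, mul_assoc]
    · left
      rw [mul_assoc, hb, ← mul_assoc, ← sgn_mul, mul_assoc, ← mul_assoc a, ha, mul_assoc,
        ← mul_assoc, sgn_mul_sgn, one_mul, mul_assoc]
  inv_mem' := by
    rintro a (ha | ha)
    · left
      rw [inv_mul_eq_iff_eq_mul, ← mul_assoc, ha, mul_assoc, mul_inv_cancel, mul_one]
    · right
      rw [inv_mul_eq_iff_eq_mul, ← mul_assoc, ← sgn_mul, mul_assoc, ← mul_assoc a, ha, mul_assoc,
        mul_assoc, mul_inv_cancel, mul_one, ← mul_assoc, sgn_mul_sgn, one_mul]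

/-- The elements commuting with a fixed one up to sign form a subgroup, so generators suffice, first
in one argument and then in the other. -/
theorem comm_or (g h : CliffordGroup ι) : g * h = h * g ∨ g * h = sgn * (h * g) := by
  have key : ∀ (i : ι) (g : CliffordGroup ι), g ∈ signCentralizer (gen i) := by
    intro i
    refine eq_top_of_gen_mem (Or.inl (sgn_mul _)) fun j => ?_
    by_cases hij : j = i
    · subst hij; exact Or.inl rfl
    · exact Or.inr (gen_mul_gen hij)
  refine eq_top_of_gen_mem (H := signCentralizer h) (Or.inl (sgn_mul _)) (fun i => ?_) g
  rcases key i h with h1 | h1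
  · exact Or.inl h1.symm
  · right
    rw [h1, ← mul_assoc, sgn_mul_sgn, one_mul]

/-- By `comm_or`, `(a * b)²` is `a² * b²` up to the central sign, so the condition is closed under
products and need only hold on generators. -/
theorem mul_self_or (g : CliffordGroup ι) : g * g = 1 ∨ g * g = sgn := by
  let H : Subgroup (CliffordGroup ι) :=
    { carrier := {g | g * g = 1 ∨ g * g = sgn}
      one_mem' := Or.inl (one_mul 1)
      mul_mem' := by
        intro a b ha hb
        have h1 : (a * b) * (a * b) = a * a * (b * b) ∨
            (a * b) * (a * b) = sgn * (a * a * (b * b)) := by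
          rcases comm_or b a with h | h
          · left
            rw [mul_assoc, ← mul_assoc b, h]
            simp only [mul_assoc]
          · right
            rw [mul_assoc, ← mul_assoc b, h, ← mul_assoc a, ← mul_assoc a, ← sgn_mul]
            simp only [mul_assoc]
        change _ ∨ _
        rcases ha with ha | ha <;> rcases hb with hb | hb <;> rcases h1 with h1 | h1 <;>
          rw [h1, ha, hb] <;> simp [sgn_mul_sgn]
      inv_mem' := by
        rintro a (ha | ha)
        · left; rw [← _root_.mul_inv_rev, ha, inv_one]
        · right
          rw [← _root_.mul_inv_rev, ha, inv_eq_iff_mul_eq_one, sgn_mul_sgn] }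
  exact eq_top_of_gen_mem (H := H) (Or.inl sgn_mul_sgn) (fun i => Or.inl (gen_mul_gen_self i)) g

/-- The quotient by the central subgroup generated by `sgn` is finitely generated, abelian and of
exponent two, hence finite; the kernel has at most two elements. -/
instance [Finite ι] : Finite (CliffordGroup ι) := by
  let Z : Subgroup (CliffordGroup ι) := Subgroup.zpowers sgn
  have hZ : Z ≤ Subgroup.center _ :=
    Subgroup.zpowers_le.2 (Subgroup.mem_center_iff.2 fun g => (sgn_mul g).symm)
  have : Z.Normal := ⟨fun n hn g => by
    rw [Subgroup.mem_center_iff.1 (hZ hn) g, mul_assoc, mul_inv_cancel, mul_one]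
    exact hn⟩
  have hs : (QuotientGroup.mk sgn : CliffordGroup ι ⧸ Z) = 1 :=
    (QuotientGroup.eq_one_iff _).2 (Subgroup.mem_zpowers _)
  let _ : CommGroup (CliffordGroup ι ⧸ Z) :=
    { (inferInstance : Group (CliffordGroup ι ⧸ Z)) with
      mul_comm := by
        intro a b
        induction a using QuotientGroup.induction_on with | H a => ?_
        induction b using QuotientGroup.induction_on with | H b => ?_
        rw [← QuotientGroup.mk_mul, ← QuotientGroup.mk_mul]
        rcases comm_or a b with h | h
        · rw [h]
        · rw [h, QuotientGroup.mk_mul, hs, one_mul] }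
  have : Group.FG (CliffordGroup ι) :=
    Group.fg_iff.2 ⟨_, PresentedGroup.closure_range_of _, Set.finite_range _⟩
  have : Finite (CliffordGroup ι ⧸ Z) := by
    apply CommGroup.finite_of_fg_isMulTorsion
    intro a
    induction a using QuotientGroup.induction_on with | H a => ?_
    refine isOfFinOrder_iff_pow_eq_one.2 ⟨2, two_pos, ?_⟩
    rw [pow_two, ← QuotientGroup.mk_mul]
    rcases mul_self_or a with h | h
    · rw [h]; rfl
    · rw [h, hs]
  have : Finite Z := by
    have : IsOfFinOrder (sgn : CliffordGroup ι) :=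
      isOfFinOrder_iff_pow_eq_one.2 ⟨2, two_pos, by rw [pow_two, sgn_mul_sgn]⟩
    exact this.finite_zpowers
  exact Finite.of_subgroup_quotient Z

/-- The subgroup generated by `H` and an involution `g` commuting with `H`. -/
def adjoin (H : Subgroup (CliffordGroup ι)) (g : CliffordGroup ι) (hg : g * g = 1)
    (hc : ∀ h ∈ H, g * h = h * g) : Subgroup (CliffordGroup ι) where
  carrier := {x | x ∈ H ∨ x * g ∈ H}
  one_mem' := Or.inl H.one_mem
  mul_mem' := by
    rintro x y (hx | hx) (hy | hy)
    · exact Or.inl (H.mul_mem hx hy)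
    · right; rw [mul_assoc]; exact H.mul_mem hx hy
    · right
      rw [mul_assoc, ← hc y hy, ← mul_assoc]
      exact H.mul_mem hx hy
    · left
      have h2 := H.mul_mem hx hy
      rwa [mul_assoc, hc _ hy, mul_assoc, hg, mul_one] at h2
  inv_mem' := by
    rintro x (hx | hx)
    · exact Or.inl (H.inv_mem hx)
    · right
      have h2 := hc _ (H.inv_mem hx)
      have hx' : x = x * g * g := by rw [mul_assoc, hg, mul_one]
      have hi : x⁻¹ * g = (x * g)⁻¹ := by
        rw [hx', _root_.mul_inv_rev (x * g), inv_eq_of_mul_eq_one_left hg, h2, mul_assoc, hg, mul_one,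
          ← hx']
      rw [hi]
      exact H.inv_mem hx

/-- A maximal elementary abelian subgroup of the Clifford group through a given generator. -/
theorem exists_maximal_subgroup [Finite ι] (i : ι) :
    ∃ H : Subgroup (CliffordGroup ι), gen i ∈ H ∧ (∀ h ∈ H, h * h = 1) ∧
      ∀ g, (∀ h ∈ H, g * h = h * g) → g * g = 1 → g ∈ H := by
  -- Only commutation with `gen i` is required, so that the trivial subgroup qualifies; maximality
  -- then forces `gen i` into `H`.
  let S : Set (Subgroup (CliffordGroup ι)) :=
    {H | (∀ h ∈ H, h * h = 1) ∧ ∀ h ∈ H, gen i * h = h * gen i}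
  obtain ⟨H, ⟨hH, hi⟩, hmax⟩ := (Set.toFinite S).exists_maximal ⟨⊥, by simp [S]⟩
  have ext : ∀ g, (∀ h ∈ H, g * h = h * g) → g * g = 1 → gen i * g = g * gen i → g ∈ H := by
    intro g hc hg hgi
    have hxx : ∀ x, x * g * g = x := fun x => by rw [mul_assoc, hg, mul_one]
    refine hmax (y := adjoin H g hg hc) ⟨?_, ?_⟩ (fun x hx => Or.inl hx)
      (Or.inr (by rw [hg]; exact H.one_mem))
    · rintro x (hx | hx)
      · exact hH x hx
      · have h1 := hH _ hx
        have h2 := hc _ hx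
        calc x * x = x * g * g * (x * g * g) := by rw [hxx]
          _ = x * g * (g * (x * g)) * g := by simp only [mul_assoc]
          _ = 1 := by rw [h2, ← mul_assoc, h1, one_mul, hg]
    · rintro x (hx | hx)
      · exact hi x hx
      · have h1 := hi _ hx
        rw [← hxx x, ← mul_assoc, h1, mul_assoc, hgi, ← mul_assoc]
  have hi' : gen i ∈ H := ext _ hi (gen_mul_gen_self i) rfl
  exact ⟨H, hi', hH,
    fun g hc hg => ext g hc hg (hc _ hi').symm⟩

end CliffordGroup

end CliffordGroup

open CliffordGroup

/-! ### Representations of the Clifford group -/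

section Lift

variable {ι V : Type*} [AddCommGroup V] [Module ℝ V]

/-- Anticommuting linear involutions define a representation of the Clifford group. -/
theorem CliffordGroup.exists_lift (q : ι → Module.End ℝ V) (h1 : ∀ i, q i * q i = 1)
    (h2 : ∀ i j, i ≠ j → q i * q j = -(q j * q i)) :
    ∃ ρ : CliffordGroup ι →* Module.End ℝ V, ρ sgn = -1 ∧ ∀ i, ρ (gen i) = q i := by
  let f : Option ι → (Module.End ℝ V)ˣ := fun o => o.elim (-1) fun i => ⟨q i, q i, h1 i, h1 i⟩
  have hf : ∀ r ∈ cliffordRels ι, FreeGroup.lift f r = 1 := by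
    rintro r (rfl | ⟨i, rfl⟩ | ⟨i, rfl⟩ | ⟨i, j, hij, rfl⟩)
    · simp [f]
    · ext1
      simp [f, h1]
    · rw [map_mul, map_inv, mul_inv_eq_one]
      ext1
      simp [f]
    · rw [map_mul, map_inv, mul_inv_eq_one]
      ext1
      simp [f, h2 i j hij]
  refine ⟨(Units.coeHom _).comp (PresentedGroup.toGroup hf), ?_, fun i => ?_⟩
  · simp [sgn, f]
  · simp [gen, f]

end Lift

/-! ### Orthogonal bases made of orbits -/

section Orbits

variable {ι V : Type*} [AddCommGroup V] [Module ℝ V]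

/-- A nonzero homogeneous vector that is an eigenvector of each element of `H`, with respect to
projections `π t` onto the homogeneous components. -/
structure IsPrimitive (ρ : CliffordGroup ι →* Module.End ℝ V) (π : ℝ → Module.End ℝ V)
    (H : Subgroup (CliffordGroup ι)) (v : V) : Prop where
  ne_zero : v ≠ 0
  eigen : ∀ h ∈ H, ρ h v = v ∨ ρ h v = -v
  homog : ∀ t, π t v = v ∨ π t v = 0

/-- Among nonzero homogeneous vectors of `W`, take one that is an eigenvector for as many elements
of `H` as possible. If `h` were missing, `v + ρ h v` would be nonzero, fixed by `h`, and still an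
eigenvector for the earlier elements, because exponent two makes `H` abelian. -/
theorem exists_isPrimitive [Finite ι] {ρ : CliffordGroup ι →* Module.End ℝ V}
    {π : ℝ → Module.End ℝ V} {H : Subgroup (CliffordGroup ι)} (hH : ∀ h ∈ H, h * h = 1)
    (hπρ : ∀ t g v, π t (ρ g v) = ρ g (π t v)) (hπ : ∀ t s v, π t (π s v) = if t = s then π s v else 0)
    (hπ0 : ∀ v, v ≠ 0 → ∃ t, π t v ≠ 0) {W : Submodule ℝ V} (hWρ : ∀ g, ∀ v ∈ W, ρ g v ∈ W)
    (hWπ : ∀ t, ∀ v ∈ W, π t v ∈ W) (hW : W ≠ ⊥) : ∃ v ∈ W, IsPrimitive ρ π H v := by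
  let S : Set V := {v | v ∈ W ∧ v ≠ 0 ∧ ∃ s, π s v = v}
  let f : V → Set (CliffordGroup ι) := fun v => {h | h ∈ H ∧ (ρ h v = v ∨ ρ h v = -v)}
  have hS : (f '' S).Nonempty := by
    obtain ⟨w, hw, hw0⟩ := Submodule.exists_mem_ne_zero_of_ne_bot hW
    obtain ⟨t, ht⟩ := hπ0 w hw0
    exact ⟨_, π t w, ⟨hWπ t w hw, ht, t, by rw [hπ, if_pos rfl]⟩, rfl⟩
  obtain ⟨_, ⟨⟨v, ⟨hvW, hv0, s, hs⟩, rfl⟩, hmax⟩⟩ :=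
    (Set.toFinite (f '' S)).exists_maximal hS
  refine ⟨v, hvW, hv0, fun h hh => ?_, fun t => ?_⟩
  · by_contra! hcon
    have hcomm : ∀ a ∈ H, a * h = h * a := by
      intro a ha
      have h1 := hH _ (H.mul_mem ha hh)
      rw [← inv_eq_iff_mul_eq_one, _root_.mul_inv_rev, inv_eq_of_mul_eq_one_left (hH a ha),
        inv_eq_of_mul_eq_one_left (hH h hh)] at h1
      exact h1.symm
    have hh2 : ρ h (ρ h v) = v := by
      rw [← Module.End.mul_apply, ← map_mul, hH h hh, map_one, Module.End.one_apply]
    have hu : v + ρ h v ∈ S := by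
      refine ⟨W.add_mem hvW (hWρ h v hvW), fun h0 => hcon.2 ?_, s, ?_⟩
      · exact (neg_eq_of_add_eq_zero_right h0).symm
      · rw [map_add, hπρ, hs]
    have hle : f v ⊆ f (v + ρ h v) := by
      rintro a ⟨ha, hav⟩
      have h1 : ρ a (ρ h v) = ρ h (ρ a v) := by
        rw [← Module.End.mul_apply, ← map_mul, hcomm a ha, map_mul, Module.End.mul_apply]
      refine ⟨ha, ?_⟩
      rcases hav with hav | hav
      · left; rw [map_add, h1, hav]
      · right; rw [map_add, h1, hav, map_neg]; abel
    have hmem : h ∈ f v := hmax ⟨_, hu, rfl⟩ hle ⟨hh, Or.inl (by rw [map_add, hh2, add_comm])⟩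
    rcases hmem.2 with h1 | h1
    exacts [hcon.1 h1, hcon.2 h1]
  · rw [← hs, hπ]
    split_ifs
    exacts [Or.inl rfl, Or.inr rfl]

variable {ρ : CliffordGroup ι →* Module.End ℝ V} {π : ℝ → Module.End ℝ V}
  {H : Subgroup (CliffordGroup ι)} {β : LinearMap.BilinForm ℝ V}

/-- If `g` commutes with `H`, maximality leaves `g² = sgn`, so `ρ g` is skew for the symmetric form.
Otherwise some `h ∈ H` anticommutes with `g`, and `ρ h`, which preserves `β`, has opposite
eigenvalues on `ρ g v` and `v`. -/
theorem IsPrimitive.orthogonal (hρ : ρ sgn = -1)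
    (hmax : ∀ g, (∀ h ∈ H, g * h = h * g) → g * g = 1 → g ∈ H)
    (hsymm : ∀ x y, β x y = β y x) (hinv : ∀ g x y, β (ρ g x) (ρ g y) = β x y)
    {v : V} (hv : IsPrimitive ρ π H v) {g : CliffordGroup ι} (hg : g ∉ H) : β (ρ g v) v = 0 := by
  by_cases hc : ∀ h ∈ H, g * h = h * g
  · have hgg : g * g = sgn := (mul_self_or g).resolve_left fun h => hg (hmax g hc h)
    have h1 := hinv g (ρ g v) v
    rw [← Module.End.mul_apply, ← map_mul, hgg, hρ, hsymm] at h1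
    simp only [LinearMap.neg_apply, Module.End.one_apply, map_neg] at h1
    linarith
  · push Not at hc
    obtain ⟨h, hh, hne⟩ := hc
    have hgh := (comm_or g h).resolve_left hne
    have h1 := hinv h (ρ g v) v
    have h2 : ρ h (ρ g v) = - ρ g (ρ h v) := by
      have h3 : ρ (g * h) v = - ρ (h * g) v := by rw [hgh, map_mul, hρ]; simp
      rw [map_mul, map_mul, Module.End.mul_apply, Module.End.mul_apply] at h3
      rw [h3, neg_neg]
    rw [h2] at h1
    rcases hv.eigen h hh with h3 | h3 <;> rw [h3] at h1 <;>
      simp only [map_neg, LinearMap.neg_apply, neg_neg] at h1 <;> linarith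

/-- A representation of the Clifford group with a form it preserves has a basis consisting of
orbits of primitive vectors. -/
theorem exists_orbit_basis [Finite ι] [FiniteDimensional ℝ V]
    (hρ : ρ sgn = -1) (hH : ∀ h ∈ H, h * h = 1)
    (hmax : ∀ g, (∀ h ∈ H, g * h = h * g) → g * g = 1 → g ∈ H)
    (hπρ : ∀ t g v, π t (ρ g v) = ρ g (π t v)) (hπ : ∀ t s v, π t (π s v) = if t = s then π s v else 0)
    (hπ0 : ∀ v, v ≠ 0 → ∃ t, π t v ≠ 0)
    (hsymm : ∀ x y, β x y = β y x) (hinv : ∀ g x y, β (ρ g x) (ρ g y) = β x y)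
    (hpos : ∀ x, x ≠ 0 → β x x ≠ 0) (hπβ : ∀ t x y, β (π t x) y = β x (π t y)) :
    ∃ (k : ℕ) (v : Fin k → V) (b : Module.Basis (Fin k × (CliffordGroup ι ⧸ H)) ℝ V),
      (∀ i, IsPrimitive ρ π H (v i)) ∧ ∀ i q, b (i, q) = ρ q.out (v i) := by
  -- Families of primitive vectors with mutually orthogonal orbits; their length is bounded by the
  -- dimension, and one that cannot be lengthened spans.
  let Fam : ℕ → Prop := fun k => ∃ v : Fin k → V, (∀ i, IsPrimitive ρ π H (v i)) ∧
    ∀ i j, i ≠ j → ∀ g, β (ρ g (v i)) (v j) = 0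
  have hinv' : ∀ g h x y, β (ρ g x) (ρ h y) = β (ρ (h⁻¹ * g) x) y := by
    intro g h x y
    rw [← hinv h (ρ (h⁻¹ * g) x) y, ← Module.End.mul_apply, ← map_mul, mul_inv_cancel_left]
  have hne : ∀ g x, x ≠ 0 → ρ g x ≠ 0 := by
    intro g x hx h0
    apply hpos x hx
    rw [← hinv g, h0, map_zero]
  have hind : ∀ k (v : Fin k → V), (∀ i, IsPrimitive ρ π H (v i)) →
      (∀ i j, i ≠ j → ∀ g, β (ρ g (v i)) (v j) = 0) →
      β.iIsOrtho (fun x : Fin k × (CliffordGroup ι ⧸ H) => ρ x.2.out (v x.1)) := by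
    rintro k v hv ho ⟨i, q⟩ ⟨j, q'⟩ hne
    change β (ρ q.out (v i)) (ρ q'.out (v j)) = 0
    rw [hinv']
    by_cases hij : i = j
    · subst hij
      refine (hv i).orthogonal hρ hmax hsymm hinv fun hmem => hne ?_
      rw [← QuotientGroup.eq, QuotientGroup.out_eq', QuotientGroup.out_eq'] at hmem
      rw [hmem]
    · exact ho i j hij _
  have hli : ∀ k (v : Fin k → V), (∀ i, IsPrimitive ρ π H (v i)) →
      (∀ i j, i ≠ j → ∀ g, β (ρ g (v i)) (v j) = 0) →
      LinearIndependent ℝ (fun x : Fin k × (CliffordGroup ι ⧸ H) => ρ x.2.out (v x.1)) :=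
    fun k v hv ho => LinearMap.BilinForm.linearIndependent_of_iIsOrtho (hind k v hv ho)
      fun x => hpos _ (hne _ _ (hv x.1).ne_zero)
  have hbound : ¬ Fam (Module.finrank ℝ V + 1) := by
    rintro ⟨v, hv, ho⟩
    have h1 := ((hli _ v hv ho).comp (fun i => (i, (1 : CliffordGroup ι))) (fun i j h => by
      simpa using h)).fintype_card_le_finrank
    simp at h1
  obtain ⟨k, ⟨v, hv, ho⟩, hk⟩ : ∃ k, Fam k ∧ ¬ Fam (k + 1) := by
    by_contra! hcon
    exact hbound (Nat.rec (motive := Fam) ⟨Fin.elim0, fun i => i.elim0, fun i => i.elim0⟩ hcon _)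
  let e := fun x : Fin k × (CliffordGroup ι ⧸ H) => ρ x.2.out (v x.1)
  have := Fintype.ofFinite (CliffordGroup ι ⧸ H)
  have hspan : ⊤ ≤ Submodule.span ℝ (Set.range e) := by
    by_contra hcon
    -- The orthogonal complement of all orbits. It is invariant under the group and the projections,
    -- so if nonzero it contains a further primitive vector.
    let W : Submodule ℝ V :=
      { carrier := {w | ∀ g i, β w (ρ g (v i)) = 0}
        zero_mem' := fun g i => by simp
        add_mem' := fun {a b} ha hb g i => by
          rw [map_add, LinearMap.add_apply, ha g i, hb g i, add_zero]
        smul_mem' := fun c a ha g i => by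
          rw [map_smul, LinearMap.smul_apply, ha g i, smul_zero] }
    have hW : W ≠ ⊥ := by
      obtain ⟨w, -, hw⟩ := Set.not_subset.1 hcon
      let u := w - ∑ x, (β w (e x) / β (e x) (e x)) • e x
      have hu0 : u ≠ 0 := by
        intro h0
        apply hw
        rw [sub_eq_zero.1 h0]
        exact Submodule.sum_mem _ fun x _ => Submodule.smul_mem _ _
          (Submodule.subset_span ⟨x, rfl⟩)
      have hue : ∀ x, β u (e x) = 0 := by
        intro x
        simp only [u, map_sub, map_sum, map_smul, LinearMap.sub_apply, LinearMap.sum_apply,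
          LinearMap.smul_apply]
        rw [Finset.sum_eq_single x]
        · rw [smul_eq_mul, div_mul_cancel₀, sub_self]
          exact hpos _ (hne _ _ (hv x.1).ne_zero)
        · intro y _ hyx
          rw [hind k v hv ho hyx, smul_zero]
        · simp
      refine (Submodule.ne_bot_iff _).2 ⟨u, fun g i => ?_, hu0⟩
      -- Changing the coset representative multiplies the orbit vector only by a sign, so
      -- orthogonality to representatives suffices.
      have hmem : (QuotientGroup.mk g : CliffordGroup ι ⧸ H).out⁻¹ * g ∈ H := by
        rw [← QuotientGroup.eq, QuotientGroup.out_eq']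
      have h1 := hue (i, QuotientGroup.mk g)
      have h2 : ρ g (v i) = ρ (QuotientGroup.mk g : CliffordGroup ι ⧸ H).out
          (ρ ((QuotientGroup.mk g : CliffordGroup ι ⧸ H).out⁻¹ * g) (v i)) := by
        rw [← Module.End.mul_apply, ← map_mul, mul_inv_cancel_left]
      rcases (hv i).eigen _ hmem with h3 | h3 <;> rw [h2, h3]
      · exact h1
      · rw [map_neg, map_neg, neg_eq_zero]; exact h1
    obtain ⟨w, hwW, hw⟩ := exists_isPrimitive hH hπρ hπ hπ0 (W := W)
      (fun g w hw h i => by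
        rw [hsymm, hinv', hsymm]
        exact hw _ i)
      (fun t w hw g i => by
        rw [hπβ, hπρ]
        rcases (hv i).homog t with h | h <;> rw [h]
        · exact hw g i
        · simp) hW
    refine hk ⟨Fin.cons w v, Fin.cases hw hv, ?_⟩
    intro i j hij g
    induction i using Fin.cases with
    | zero =>
      induction j using Fin.cases with
      | zero => exact absurd rfl hij
      | succ j =>
        rw [Fin.cons_zero, Fin.cons_succ, ← hinv g⁻¹, ← Module.End.mul_apply, ← map_mul,
          inv_mul_cancel, map_one]
        exact hwW g⁻¹ j
    | succ i =>
      induction j using Fin.cases with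
      | zero => rw [Fin.cons_zero, Fin.cons_succ, hsymm]; exact hwW g i
      | succ j => exact ho i j (fun h => hij (by rw [h])) g
  exact ⟨k, v, Module.Basis.mk (hli k v hv ho) hspan, hv, fun i q => by simp⟩

end Orbits

/-! ### Invariant inner product -/

section InvariantForm

variable {G n : Type*} [Group G] [Finite G] [Fintype n]

/-- A representation of a finite group on `n → ℝ` preserves a positive definite form, for which the
homogeneous components it preserves are orthogonal. -/
theorem exists_invariant_form (ρ : G →* Module.End ℝ (n → ℝ)) (π : ℝ → Module.End ℝ (n → ℝ))
    (hπρ : ∀ t g v, π t (ρ g v) = ρ g (π t v))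
    (hπ : ∀ t x y, π t x ⬝ᵥ y = x ⬝ᵥ π t y) :
    ∃ β : LinearMap.BilinForm ℝ (n → ℝ), (∀ x y, β x y = β y x) ∧
      (∀ g x y, β (ρ g x) (ρ g y) = β x y) ∧ (∀ x, x ≠ 0 → β x x ≠ 0) ∧
      ∀ t x y, β (π t x) y = β x (π t y) := by
  have := Fintype.ofFinite G
  -- The dot product summed over the group.
  let β : LinearMap.BilinForm ℝ (n → ℝ) :=
    ∑ g, (dotProductBilin ℝ ℝ).compl₁₂ (ρ g) (ρ g)
  have hβ : ∀ x y, β x y = ∑ g, ρ g x ⬝ᵥ ρ g y := by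
    intro x y
    simp [β, LinearMap.sum_apply, dotProductBilin]
  refine ⟨β, fun x y => ?_, fun g x y => ?_, fun x hx => ?_, fun t x y => ?_⟩
  · simp only [hβ, dotProduct_comm]
  · rw [hβ, hβ, ← Equiv.sum_comp (Equiv.mulRight g) fun h => ρ h x ⬝ᵥ ρ h y]
    simp [Module.End.mul_apply]
  · have hnn : ∀ y : n → ℝ, 0 ≤ y ⬝ᵥ y := fun y => Finset.sum_nonneg fun _ _ => mul_self_nonneg _
    rw [hβ]
    refine (Finset.sum_pos' (fun g _ => hnn _) ⟨1, Finset.mem_univ _, ?_⟩).ne'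
    rw [map_one, Module.End.one_apply]
    exact (hnn x).lt_of_ne fun h => hx (dotProduct_self_eq_zero.1 h.symm)
  · simp only [hβ, ← hπρ, hπ]

end InvariantForm

/-! ### The representation at `∂ = 1` -/

section Representation

variable {N : ℕ} {B F : Type*} [Fintype B] [DecidableEq B] [Fintype F] [DecidableEq F]

/-- The matrices of the fermion parity (`none`) and of the supercharges (without the factor `i`)
on the component fields, at `∂ = 1`. -/
noncomputable def Supermultiplet.evalCharge (M : Supermultiplet N B F) (o : Option (Fin N)) :
    Matrix (B ⊕ F) (B ⊕ F) ℝ :=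
  o.elim (fromBlocks 1 0 0 (-1)) fun I =>
    fromBlocks 0 ((M.L I).map (evalRingHom 1)) ((M.R I).map (evalRingHom 1)) 0

theorem Supermultiplet.evalL_mul_evalR (M : Supermultiplet N B F) (I : Fin N) :
    (M.L I).map (evalRingHom 1) * (M.R I).map (evalRingHom 1) = 1 := by
  rw [← Matrix.map_mul, M.L_mul_R]
  ext1 a b
  by_cases h : a = b
  · subst h; simp
  · simp [h]

theorem Supermultiplet.evalR_mul_evalL (M : Supermultiplet N B F) (I : Fin N) :
    (M.R I).map (evalRingHom 1) * (M.L I).map (evalRingHom 1) = 1 := by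
  rw [← Matrix.map_mul, M.R_mul_L]
  ext1 a b
  by_cases h : a = b
  · subst h; simp
  · simp [h]

theorem Supermultiplet.evalCharge_mul_self (M : Supermultiplet N B F) (o : Option (Fin N)) :
    M.evalCharge o * M.evalCharge o = 1 := by
  rcases o with _ | I
  · simp [evalCharge, fromBlocks_multiply]
  · simp [evalCharge, fromBlocks_multiply, -coe_evalRingHom, evalL_mul_evalR, evalR_mul_evalL]

theorem Supermultiplet.evalCharge_anticomm (M : Supermultiplet N B F) {o o' : Option (Fin N)}
    (h : o ≠ o') : M.evalCharge o * M.evalCharge o' = -(M.evalCharge o' * M.evalCharge o) := by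
  rcases o with _ | I <;> rcases o' with _ | J
  · exact absurd rfl h
  · simp [evalCharge, fromBlocks_multiply, fromBlocks_neg]
  · simp [evalCharge, fromBlocks_multiply, fromBlocks_neg]
  · have hIJ : I ≠ J := fun e => h (by rw [e])
    have hB := congrArg (fun A => A.map (evalRingHom (1 : ℝ))) (M.susy_boson I J)
    have hF := congrArg (fun A => A.map (evalRingHom (1 : ℝ))) (M.susy_fermion I J)
    simp only [Matrix.map_add _ (map_add _), Matrix.map_mul, if_neg hIJ, zero_smul,
      Matrix.map_zero _ (map_zero _)] at hB hF
    simp only [evalCharge, Option.elim_some, fromBlocks_multiply, fromBlocks_neg, Matrix.zero_mul,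
      Matrix.mul_zero, zero_add, add_zero, eq_neg_of_add_eq_zero_left hB,
      eq_neg_of_add_eq_zero_left hF, neg_zero]

/-- At `∂ = 1` the fields of a supermultiplet span a representation of the Clifford group. -/
theorem Supermultiplet.exists_representation (M : Supermultiplet N B F) :
    ∃ ρ : CliffordGroup (Option (Fin N)) →* Module.End ℝ (B ⊕ F → ℝ), ρ sgn = -1 ∧
      ∀ o v, ρ (gen o) v = v ᵥ* M.evalCharge o := by
  -- Coefficient vectors of combinations of fields are rows, hence the transposes; reversing
  -- products does not affect the Clifford relations.
  obtain ⟨ρ, h1, h2⟩ := CliffordGroup.exists_lift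
    (fun o : Option (Fin N) => toLinAlgEquiv' (M.evalCharge o)ᵀ)
    (fun o => by rw [← map_mul, ← transpose_mul, M.evalCharge_mul_self, transpose_one, map_one])
    (fun o o' h => by
      rw [← map_mul, ← map_mul, ← map_neg, ← transpose_mul, ← transpose_mul, ← transpose_neg,
        M.evalCharge_anticomm h.symm])
  exact ⟨ρ, h1, fun o v => by rw [h2, toLinAlgEquiv'_apply, mulVec_transpose]⟩

/-- The projection onto the vectors supported where `δ` takes the value `t`. -/
noncomputable def gradeProj {n : Type*} (δ : n → ℝ) (t : ℝ) : Module.End ℝ (n → ℝ) where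
  toFun v x := if δ x = t then v x else 0
  map_add' v w := by
    ext x
    simp only [Pi.add_apply]
    split_ifs <;> simp
  map_smul' c v := by
    ext x
    simp

/-- The fields of a supermultiplet at `∂ = 1` have a basis of eigenvectors of the fermion parity,
homogeneous for a grading compatible with the supercharges, that the supercharges permute up to
sign. -/
theorem Supermultiplet.exists_monomial_basis (M : Supermultiplet N B F) {δ : B ⊕ F → ℝ}
    (hδ : ∀ o x y, M.evalCharge o x y ≠ 0 → δ x = δ y)
    {H : Subgroup (CliffordGroup (Option (Fin N)))} (hP : gen none ∈ H) (hH : ∀ h ∈ H, h * h = 1)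
    (hmax : ∀ g, (∀ h ∈ H, g * h = h * g) → g * g = 1 → g ∈ H) :
    ∃ (k : ℕ) (t : Fin k → ℝ)
      (b : Module.Basis (Fin k × (CliffordGroup (Option (Fin N)) ⧸ H)) ℝ (B ⊕ F → ℝ)),
      (∀ i q x, b (i, q) x ≠ 0 → δ x = t i) ∧
      (∀ i q, b (i, q) ᵥ* M.evalCharge none = b (i, q) ∨
        b (i, q) ᵥ* M.evalCharge none = -b (i, q)) ∧
      ∀ I i q, ∃ q', ∃ s : ℝ, (s = 1 ∨ s = -1) ∧
        b (i, q) ᵥ* M.evalCharge (some I) = s • b (i, q') := by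
  obtain ⟨ρ, hρ, hρg⟩ := M.exists_representation
  have hπρ : ∀ t g v, gradeProj δ t (ρ g v) = ρ g (gradeProj δ t v) := by
    intro t g
    let S : Subgroup (CliffordGroup (Option (Fin N))) :=
      { carrier := {g | ∀ v, gradeProj δ t (ρ g v) = ρ g (gradeProj δ t v)}
        one_mem' := fun v => by simp
        mul_mem' := fun {a b} ha hb v => by
          rw [map_mul, Module.End.mul_apply, Module.End.mul_apply, ha, hb]
        inv_mem' := fun {a} ha v => by
          have h1 := ha (ρ a⁻¹ v)
          rw [← Module.End.mul_apply (ρ a), ← map_mul, mul_inv_cancel, map_one,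
            Module.End.one_apply] at h1
          rw [h1, ← Module.End.mul_apply (ρ a⁻¹), ← map_mul, inv_mul_cancel, map_one,
            Module.End.one_apply] }
    refine eq_top_of_gen_mem (H := S) (fun v => by simp [hρ]) (fun o v => ?_) g
    rw [hρg, hρg]
    ext y
    simp only [gradeProj, LinearMap.coe_mk, AddHom.coe_mk, vecMul, dotProduct]
    split_ifs with hy
    · refine Finset.sum_congr rfl fun x _ => ?_
      split_ifs with hx
      · rfl
      · by_cases h0 : M.evalCharge o x y = 0
        · rw [h0, mul_zero, mul_zero]
        · exact absurd ((hδ o x y h0).trans hy) hx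
    · symm
      refine Finset.sum_eq_zero fun x _ => ?_
      split_ifs with hx
      · by_cases h0 : M.evalCharge o x y = 0
        · rw [h0, mul_zero]
        · exact absurd ((hδ o x y h0).symm.trans hx) hy
      · rw [zero_mul]
  have hπ : ∀ t s v, gradeProj δ t (gradeProj δ s v) = if t = s then gradeProj δ s v else 0 := by
    intro t s v
    ext x
    by_cases hts : t = s
    · subst hts
      by_cases hx : δ x = t <;> simp [gradeProj, hx]
    · rw [if_neg hts]
      simp only [gradeProj, LinearMap.coe_mk, AddHom.coe_mk, Pi.zero_apply]
      split_ifs with h1 h2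
      · exact absurd (h1.symm.trans h2) hts
      · rfl
      · rfl
  have hπ0 : ∀ v, v ≠ 0 → ∃ t, gradeProj δ t v ≠ 0 := by
    intro v hv
    obtain ⟨x, hx⟩ := Function.ne_iff.1 hv
    refine ⟨δ x, Function.ne_iff.2 ⟨x, ?_⟩⟩
    simpa [gradeProj] using hx
  have hπd : ∀ t x y, gradeProj δ t x ⬝ᵥ y = x ⬝ᵥ gradeProj δ t y := by
    intro t x y
    refine Finset.sum_congr rfl fun a _ => ?_
    simp [gradeProj]
  obtain ⟨β, hsymm, hinv, hpos, hπβ⟩ := exists_invariant_form ρ (gradeProj δ) hπρ hπd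
  obtain ⟨k, v, b, hv, hb⟩ := exists_orbit_basis hρ hH hmax hπρ hπ hπ0 hsymm hinv hpos hπβ
  have ht : ∀ i, ∃ t, gradeProj δ t (v i) = v i := by
    intro i
    obtain ⟨t, ht⟩ := hπ0 _ (hv i).ne_zero
    exact ⟨t, ((hv i).homog t).resolve_right ht⟩
  choose t ht using ht
  refine ⟨k, t, b, fun i q x hx => ?_, fun i q => ?_, fun I i q => ?_⟩
  · rw [hb, ← ht i, ← hπρ] at hx
    by_contra hne
    simp [gradeProj, hne] at hx
  · rw [← hρg, hb, ← Module.End.mul_apply, ← map_mul]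
    rcases comm_or (gen none) q.out with h | h <;> rw [h] <;> simp only [map_mul, hρ] <;>
      rcases (hv i).eigen _ hP with h2 | h2 <;> simp [Module.End.mul_apply, h2]
  -- A supercharge moves the coset `q` to `gen (some I) * q`; the discrepancy from the chosen
  -- representative lies in `H` and acts on `v i` by a sign.
  · have hmem : (QuotientGroup.mk (gen (some I) * q.out) : _ ⧸ H).out⁻¹ *
        (gen (some I) * q.out) ∈ H := by
      rw [← QuotientGroup.eq, QuotientGroup.out_eq']
    refine ⟨QuotientGroup.mk (gen (some I) * q.out), ?_⟩
    have h1 : b (i, q) ᵥ* M.evalCharge (some I) =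
        ρ (QuotientGroup.mk (gen (some I) * q.out) : _ ⧸ H).out
          (ρ ((QuotientGroup.mk (gen (some I) * q.out) : _ ⧸ H).out⁻¹ *
            (gen (some I) * q.out)) (v i)) := by
      rw [← hρg, hb, ← Module.End.mul_apply, ← Module.End.mul_apply, ← map_mul, ← map_mul,
        mul_inv_cancel_left]
    rw [h1, hb]
    rcases (hv i).eigen _ hmem with h2 | h2 <;> rw [h2]
    · exact ⟨1, Or.inl rfl, by rw [one_smul]⟩
    · exact ⟨-1, Or.inr rfl, by rw [map_neg, neg_one_smul]⟩

/-- With the trivial grading, the orbit basis shows that the number of fields is a multiple of the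
index of `H`. -/
theorem Supermultiplet.card_quotient_le (M : Supermultiplet N B F)
    {H : Subgroup (CliffordGroup (Option (Fin N)))} (hP : gen none ∈ H) (hH : ∀ h ∈ H, h * h = 1)
    (hmax : ∀ g, (∀ h ∈ H, g * h = h * g) → g * g = 1 → g ∈ H)
    (h0 : 0 < Fintype.card B + Fintype.card F) :
    Nat.card (CliffordGroup (Option (Fin N)) ⧸ H) ≤ Fintype.card B + Fintype.card F := by
  obtain ⟨k, -, b, -⟩ := M.exists_monomial_basis (δ := 0) (fun _ _ _ _ => rfl) hP hH hmax
  have h1 := Module.finrank_eq_nat_card_basis b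
  rw [Module.finrank_fintype_fun_eq_card, Fintype.card_sum, Nat.card_prod, Nat.card_fin] at h1
  rw [h1] at h0 ⊢
  exact Nat.le_mul_of_pos_left _ (Nat.pos_of_mul_pos_right h0)

end Representation

/-! ### Block and graded inverses -/

section Blocks

/-- A basis adapted to a splitting of the coordinates gives invertible matrices. -/
theorem exists_inverse_of_adapted_basis {m n B F : Type*} [Fintype m] [DecidableEq m] [Fintype n]
    [DecidableEq n] [Fintype B] [DecidableEq B] [Fintype F] [DecidableEq F]
    (b : Module.Basis (m ⊕ n) ℝ (B ⊕ F → ℝ)) (h1 : ∀ j α, b (.inl j) (.inr α) = 0)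
    (h2 : ∀ j a, b (.inr j) (.inl a) = 0) {x : Matrix m B ℝ} {y : Matrix n F ℝ}
    (hx : ∀ j a, x j a = b (.inl j) (.inl a)) (hy : ∀ j α, y j α = b (.inr j) (.inr α)) :
    ∃ (u : Matrix B m ℝ) (v : Matrix F n ℝ), x * u = 1 ∧ u * x = 1 ∧ y * v = 1 ∧ v * y = 1 := by
  let e := Pi.basisFun ℝ (B ⊕ F)
  have hW : (e.toMatrix b)ᵀ = fromBlocks x 0 0 y := by
    ext (i | i) (j | j) <;> simp [e, Module.Basis.toMatrix_apply, h1, h2, hx, hy]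
  have e1 := congrArg transpose (e.toMatrix_mul_toMatrix_flip b)
  have e2 := congrArg transpose (b.toMatrix_mul_toMatrix_flip e)
  rw [transpose_mul, hW, transpose_one] at e1 e2
  rw [← fromBlocks_toBlocks (b.toMatrix e)ᵀ, fromBlocks_multiply, ← fromBlocks_one,
    fromBlocks_inj] at e1 e2
  simp only [Matrix.zero_mul, Matrix.mul_zero, add_zero, zero_add] at e1 e2
  exact ⟨_, _, e2.1, e1.1, e2.2.2.2, e1.2.2.2⟩

/-- The inverse of a graded matrix is graded. -/
theorem graded_inverse {m n : Type*} [Fintype m] [DecidableEq m] [Fintype n] [DecidableEq n]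
    {x : Matrix m n ℝ} {u : Matrix n m ℝ} (h1 : x * u = 1) (h2 : u * x = 1) {d : m → ℝ}
    {e : n → ℝ} (hx : ∀ i j, x i j ≠ 0 → e j = d i) (j : n) (i : m) (h : u j i ≠ 0) :
    e j = d i := by
  -- Being graded means intertwining the two diagonal matrices of degrees, a property that passes to
  -- the inverse.
  have hc : x * diagonal e = diagonal d * x := by
    ext i j
    rw [mul_diagonal, diagonal_mul]
    by_cases h0 : x i j = 0
    · rw [h0, zero_mul, mul_zero]
    · rw [hx i j h0, mul_comm]
  have hu : diagonal e * u = u * diagonal d := by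
    calc diagonal e * u = (u * x) * diagonal e * u := by rw [h2, Matrix.one_mul]
      _ = u * (diagonal d * (x * u)) := by rw [Matrix.mul_assoc u, hc]; simp only [Matrix.mul_assoc]
      _ = _ := by rw [h1, Matrix.mul_one]
  have h3 := congrFun (congrFun hu j) i
  rw [mul_diagonal, diagonal_mul, mul_comm] at h3
  exact mul_left_cancel₀ h h3

end Blocks

/-! ### Dimensions in a half-open unit window -/

section PartnerDim

/-- The engineering dimension in `[T - 1, T)` that differs by `1 / 2` from the given one. -/
noncomputable def partnerDim (T t : ℝ) : ℝ := if t + 1 / 2 < T then t + 1 / 2 else t - 1 / 2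

/-- The number of derivatives in the transformation of a field of dimension `t` into one of
dimension `partnerDim T t`. -/
noncomputable def partnerExp (T t : ℝ) : ℕ := if t + 1 / 2 < T then 0 else 1

theorem partnerExp_le_one (T t : ℝ) : partnerExp T t ≤ 1 := by
  unfold partnerExp
  split_ifs <;> omega

theorem add_half_eq_partnerDim (T t : ℝ) : t + 1 / 2 = partnerDim T t + partnerExp T t := by
  unfold partnerDim partnerExp
  split_ifs <;> push_cast <;> ring

theorem partnerDim_add_half (T t : ℝ) :
    partnerDim T t + 1 / 2 = t + (1 - partnerExp T t : ℕ) := by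
  unfold partnerDim partnerExp
  split_ifs <;> push_cast <;> ring

theorem partnerDim_partnerDim {T t : ℝ} (h1 : T - 1 ≤ t) (h2 : t < T) :
    partnerDim T (partnerDim T t) = t := by
  unfold partnerDim
  split_ifs <;> linarith

/-- The window has length one, so `n` is `0` or `1`; being half-open, it contains exactly one of `t
+ 1/2` and `t - 1/2`. -/
theorem eq_partnerDim {T t f : ℝ} {n : ℕ} (ht2 : t < T) (hf1 : T - 1 ≤ f)
    (hf2 : f < T) (h : t + 1 / 2 = f + n) : f = partnerDim T t ∧ n = partnerExp T t := by
  have hn : n < 2 := by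
    have : (n : ℝ) < 2 := by linarith
    exact_mod_cast this
  unfold partnerDim partnerExp
  interval_cases n <;> push_cast at h <;> split_ifs <;> constructor <;> linarith

theorem eq_partnerDim' {T t f : ℝ} {n : ℕ} (ht1 : T - 1 ≤ t) (hf1 : T - 1 ≤ f)
    (hf2 : f < T) (h : f + 1 / 2 = t + n) : f = partnerDim T t ∧ n = 1 - partnerExp T t := by
  have hn : n < 2 := by
    have : (n : ℝ) < 2 := by linarith
    exact_mod_cast this
  unfold partnerDim partnerExp
  interval_cases n <;> push_cast at h <;> split_ifs <;> constructor <;> first | linarith | rfl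

/-- This is what allows homogeneous rules to be recovered from their values at `∂ = 1`. -/
theorem eq_C_eval_one_mul_X_pow {p : ℝ[X]} {n : ℕ} (h : ∀ m, p.coeff m ≠ 0 → m = n) :
    p = C (p.eval 1) * X ^ n := by
  have h1 : p = C (p.coeff n) * X ^ n := by
    ext m
    rw [coeff_C_mul, coeff_X_pow]
    by_cases hm : m = n
    · simp [hm]
    · rw [if_neg hm, mul_zero]
      by_contra h0
      exact hm (h m h0)
  have h2 := congrArg (eval 1) h1
  rw [eval_mul, eval_C, eval_pow, eval_X, one_pow, mul_one] at h2
  rwa [h2]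

end PartnerDim

/-! ### Splitting orbits into bosons and fermions -/

section Decomposition

variable {N : ℕ} {B F : Type*} [Fintype B] [DecidableEq B] [Fintype F] [DecidableEq F]

theorem EngSupermultiplet.exists_monomial_frame (M : EngSupermultiplet N B F) {T : ℝ}
    (hB : ∀ a, T - 1 ≤ M.dimB a ∧ M.dimB a < T) (hF : ∀ α, T - 1 ≤ M.dimF α ∧ M.dimF α < T)
    {H : Subgroup (CliffordGroup (Option (Fin N)))} (hP : gen none ∈ H) (hH : ∀ h ∈ H, h * h = 1)
    (hmax : ∀ g, (∀ h ∈ H, g * h = h * g) → g * g = 1 → g ∈ H) :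
    ∃ (k : ℕ) (p f : Fin k → ℕ) (t : Fin k → ℝ)
      (x : Matrix (Σ i, Fin (p i)) B ℝ) (u : Matrix B (Σ i, Fin (p i)) ℝ)
      (y : Matrix (Σ i, Fin (f i)) F ℝ) (v : Matrix F (Σ i, Fin (f i)) ℝ),
      x * u = 1 ∧ u * x = 1 ∧ y * v = 1 ∧ v * y = 1 ∧
      (∀ i, p i + f i = Nat.card (CliffordGroup (Option (Fin N)) ⧸ H)) ∧
      (∀ j a, x j a ≠ 0 → M.dimB a = t j.1) ∧
      (∀ j α, y j α ≠ 0 → M.dimF α = partnerDim T (t j.1)) ∧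
      ∀ I i,
        let Edge (j : Fin (p i)) (j' : Fin (f i)) : Prop := ∃ s : ℝ, (s = 1 ∨ s = -1) ∧
          x ⟨i, j⟩ ᵥ* (M.L I).map (evalRingHom 1) = s • y ⟨i, j'⟩ ∧
          y ⟨i, j'⟩ ᵥ* (M.R I).map (evalRingHom 1) = s • x ⟨i, j⟩
        (∀ j, ∃ j', Edge j j') ∧ ∀ j', ∃ j, Edge j j' := by
  classical
  -- Assigning to each fermion the dimension of its bosonic partners gives a grading that the
  -- supercharges preserve, so every orbit can be taken homogeneous.
  let δ : B ⊕ F → ℝ := Sum.elim M.dimB fun α => partnerDim T (M.dimF α)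
  have hcoeff : ∀ q : ℝ[X], q.eval 1 ≠ 0 → ∃ n, q.coeff n ≠ 0 := by
    intro q hq
    by_contra! h0
    exact hq (by rw [show q = 0 from Polynomial.ext h0, eval_zero])
  have hδ : ∀ o x y, M.evalCharge o x y ≠ 0 → δ x = δ y := by
    rintro (_ | I) (a | α) (b | β) h
    · by_cases hab : a = b
      · rw [hab]
      · simp [Supermultiplet.evalCharge, hab] at h
    · simp [Supermultiplet.evalCharge] at h
    · simp [Supermultiplet.evalCharge] at h
    · by_cases hab : α = β
      · rw [hab]
      · simp [Supermultiplet.evalCharge, hab] at h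
    · simp [Supermultiplet.evalCharge] at h
    · obtain ⟨n, hn⟩ := hcoeff (M.L I a β) (by simpa [Supermultiplet.evalCharge] using h)
      have h2 := (eq_partnerDim (hB a).2 (hF β).1 (hF β).2 (M.homog_L I a β n hn)).1
      change M.dimB a = partnerDim T (M.dimF β)
      rw [h2, partnerDim_partnerDim (hB a).1 (hB a).2]
    · obtain ⟨n, hn⟩ := hcoeff (M.R I α b) (by simpa [Supermultiplet.evalCharge] using h)
      have h2 := (eq_partnerDim' (hB b).1 (hF α).1 (hF α).2 (M.homog_R I α b n hn)).1
      change partnerDim T (M.dimF α) = M.dimB b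
      rw [h2, partnerDim_partnerDim (hB b).1 (hB b).2]
    · simp [Supermultiplet.evalCharge] at h
  obtain ⟨k, t, b, hbt, hbP, hbQ⟩ := M.exists_monomial_basis hδ hP hH hmax
  have := Fintype.ofFinite (CliffordGroup (Option (Fin N)) ⧸ H)
  -- Each basis vector is a parity eigenvector, hence purely bosonic or purely fermionic.
  let isB : Fin k → (CliffordGroup (Option (Fin N)) ⧸ H) → Prop := fun i q =>
    b (i, q) ∘ Sum.inr = 0
  have hb0 : ∀ i q, b (i, q) ≠ 0 := fun i q => b.ne_zero _
  have hnB : ∀ i q, ¬ isB i q → b (i, q) ∘ Sum.inl = 0 := by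
    intro i q hq
    have hv : ∀ w : B ⊕ F → ℝ, w ᵥ* M.evalCharge none = Sum.elim (w ∘ .inl) (-(w ∘ .inr)) := by
      intro w
      simp [Supermultiplet.evalCharge, vecMul_fromBlocks, vecMul_neg]
    rcases hbP i q with h | h <;> rw [hv] at h
    · exfalso
      apply hq
      funext α
      have := congrFun h (.inr α)
      simp only [Sum.elim_inr, Pi.neg_apply, Function.comp_apply] at this
      simp only [Function.comp_apply, Pi.zero_apply]
      linarith
    · funext a
      have := congrFun h (.inl a)
      simp only [Sum.elim_inl, Pi.neg_apply, Function.comp_apply] at this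
      simp only [Function.comp_apply, Pi.zero_apply]
      linarith
  have hex : ∀ w : B ⊕ F → ℝ, w ∘ Sum.inl = 0 → w ∘ Sum.inr = 0 → w = 0 := by
    intro w h1 h2
    funext z
    rcases z with a | α
    exacts [congrFun h1 a, congrFun h2 α]
  let eB : ∀ i, Fin (Fintype.card {q // isB i q}) ≃ {q // isB i q} :=
    fun i => (Fintype.equivFin _).symm
  let eF : ∀ i, Fin (Fintype.card {q // ¬ isB i q}) ≃ {q // ¬ isB i q} :=
    fun i => (Fintype.equivFin _).symm
  let e : (Σ i, Fin (Fintype.card {q // isB i q})) ⊕ (Σ i, Fin (Fintype.card {q // ¬ isB i q})) ≃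
      Fin k × (CliffordGroup (Option (Fin N)) ⧸ H) :=
    (Equiv.sigmaSumDistrib _ _).symm.trans ((Equiv.sigmaCongrRight fun i =>
      (Equiv.sumCongr (eB i) (eF i)).trans (Equiv.sumCompl (isB i))).trans
        (Equiv.sigmaEquivProd _ _))
  let x : Matrix (Σ i, Fin (Fintype.card {q // isB i q})) B ℝ :=
    fun j => b (j.1, (eB j.1 j.2).1) ∘ Sum.inl
  let y : Matrix (Σ i, Fin (Fintype.card {q // ¬ isB i q})) F ℝ :=
    fun j => b (j.1, (eF j.1 j.2).1) ∘ Sum.inr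
  have hel : ∀ j, b.reindex e.symm (.inl j) = b (j.1, (eB j.1 j.2).1) := fun j => by
    rw [Module.Basis.reindex_apply]; rfl
  have her : ∀ j, b.reindex e.symm (.inr j) = b (j.1, (eF j.1 j.2).1) := fun j => by
    rw [Module.Basis.reindex_apply]; rfl
  obtain ⟨u, v, h1, h2, h3, h4⟩ := exists_inverse_of_adapted_basis (b.reindex e.symm)
    (fun j α => by rw [hel]; exact congrFun (eB j.1 j.2).2 α)
    (fun j a => by rw [her]; exact congrFun (hnB _ _ (eF j.1 j.2).2) a)
    (x := x) (y := y) (fun j a => by rw [hel]; rfl) (fun j α => by rw [her]; rfl)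
  refine ⟨k, _, _, t, x, u, y, v, h1, h2, h3, h4, fun i => ?_, fun j a h => hbt _ _ _ h,
    fun j α h => ?_, fun I i => ?_⟩
  · rw [← Fintype.card_sum, Nat.card_eq_fintype_card]
    exact Fintype.card_congr (Equiv.sumCompl (isB i))
  · have h5 : partnerDim T (M.dimF α) = t j.1 := hbt _ _ _ h
    rw [← h5, partnerDim_partnerDim (hF α).1 (hF α).2]
  have hQ : ∀ w : B ⊕ F → ℝ, w ᵥ* M.evalCharge (some I) =
      Sum.elim ((w ∘ .inr) ᵥ* (M.R I).map (evalRingHom 1))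
        ((w ∘ .inl) ᵥ* (M.L I).map (evalRingHom 1)) := by
    intro w
    simp only [Supermultiplet.evalCharge, Option.elim_some, vecMul_fromBlocks, vecMul_zero,
      zero_add, add_zero]
  have hs2 : ∀ s : ℝ, s = 1 ∨ s = -1 → s * s = 1 := by
    rintro s (rfl | rfl) <;> norm_num
  constructor
  · intro j
    obtain ⟨q', s, hs, hq'⟩ := hbQ I i (eB i j).1
    rw [hQ, (eB i j).2, zero_vecMul] at hq'
    have hl : b (i, q') ∘ Sum.inl = 0 := by
      funext a
      have := congrFun hq' (.inl a)
      simp only [Sum.elim_inl, Pi.zero_apply, Pi.smul_apply, smul_eq_mul] at this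
      rcases mul_eq_zero.1 this.symm with h0 | h0
      · rw [h0] at hs; norm_num at hs
      · exact h0
    have hn : ¬ isB i q' := fun hB' => hb0 i q' (hex _ hl hB')
    have hr : x ⟨i, j⟩ ᵥ* (M.L I).map (evalRingHom 1) = s • y ⟨i, (eF i).symm ⟨q', hn⟩⟩ := by
      funext α
      have := congrFun hq' (.inr α)
      simpa [y] using this
    refine ⟨(eF i).symm ⟨q', hn⟩, s, hs, hr, ?_⟩
    have h5 := congrArg (· ᵥ* (M.R I).map (evalRingHom 1)) hr
    simp only [vecMul_vecMul, smul_vecMul] at h5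
    rw [M.evalL_mul_evalR, vecMul_one] at h5
    rw [h5, smul_smul, hs2 s hs, one_smul]
  · intro j
    obtain ⟨q', s, hs, hq'⟩ := hbQ I i (eF i j).1
    rw [hQ, hnB _ _ (eF i j).2, zero_vecMul] at hq'
    have hn : isB i q' := by
      funext α
      have := congrFun hq' (.inr α)
      simp only [Sum.elim_inr, Pi.zero_apply, Pi.smul_apply, smul_eq_mul] at this
      rcases mul_eq_zero.1 this.symm with h0 | h0
      · rw [h0] at hs; norm_num at hs
      · exact h0
    have hr : y ⟨i, j⟩ ᵥ* (M.R I).map (evalRingHom 1) = s • x ⟨i, (eB i).symm ⟨q', hn⟩⟩ := by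
      funext α
      have := congrFun hq' (.inl α)
      simpa [x] using this
    refine ⟨(eB i).symm ⟨q', hn⟩, s, hs, ?_, hr⟩
    have h5 := congrArg (· ᵥ* (M.L I).map (evalRingHom 1)) hr
    simp only [vecMul_vecMul, smul_vecMul] at h5
    rw [M.evalR_mul_evalL, vecMul_one] at h5
    rw [h5, smul_smul, hs2 s hs, one_smul]

end Decomposition

/-! ### Restoring `∂`: the orbits are minimal valise Adinkras -/

section Valises

theorem partnerExp_partnerDim {T t : ℝ} (h1 : T - 1 ≤ t) (h2 : t < T) :
    partnerExp T (partnerDim T t) = 1 - partnerExp T t := by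
  unfold partnerExp partnerDim
  split_ifs <;> first | rfl | (exfalso; linarith)

/-- A homogeneous combination of rows of monomials, computed at `∂ = 1`. -/
theorem sum_monomial_rows {A A' : Type*} [Fintype A] {P : Matrix A A' ℝ[X]} {d : A → ℝ} {T : ℝ}
    (hP : ∀ a b n, (P a b).coeff n ≠ 0 → n = partnerExp T (d a)) {x : A → ℝ} {t : ℝ}
    (hx : ∀ a, x a ≠ 0 → d a = t) {y : A' → ℝ} {s : ℝ}
    (h : x ᵥ* P.map (evalRingHom 1) = s • y) (b : A') :
    ∑ a, C (x a) * P a b = C s * X ^ partnerExp T t * C (y b) := by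
  have h5 := congrArg C (congrFun h b)
  simp only [vecMul, dotProduct, map_sum, map_apply, Pi.smul_apply, smul_eq_mul, C_mul,
    coe_evalRingHom] at h5
  rw [mul_right_comm, ← h5, Finset.sum_mul]
  refine Finset.sum_congr rfl fun a _ => ?_
  by_cases h0 : x a = 0
  · simp [h0]
  · rw [← hx _ h0, mul_assoc, ← eq_C_eval_one_mul_X_pow (hP a b)]

theorem mul_row_eq_single {m n A A' : Type*} [Fintype A] [Fintype A'] [DecidableEq n]
    {U : Matrix m A ℝ[X]} {P : Matrix A A' ℝ[X]} {V' : Matrix n A' ℝ[X]} {V : Matrix A' n ℝ[X]}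
    (hV : V' * V = 1) {j : m} {j' : n} {q : ℝ[X]} (h : ∀ b, (U * P) j b = q * V' j' b) :
    (U * P * V) j = Pi.single j' q := by
  funext l
  have h1 := congrFun (congrFun hV j') l
  rw [Matrix.mul_apply] at h1 ⊢
  simp only [h, mul_assoc]
  rw [← Finset.mul_sum, h1, one_apply, Pi.single_apply]
  simp [eq_comm]

/-- For a single summand `V * V'` is only a projection, not the identity; it acts trivially on the
rows of `U * P` because these are multiples of rows of `V'`. -/
theorem mul_row_intertwine {m n A A' : Type*} [Fintype A] [Fintype A'] [Fintype n] [DecidableEq n]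
    {U : Matrix m A ℝ[X]} {P : Matrix A A' ℝ[X]} {V' : Matrix n A' ℝ[X]} {V : Matrix A' n ℝ[X]}
    (hV : V' * V = 1) (h : ∀ j, ∃ j' q, ∀ b, (U * P) j b = q * V' j' b) :
    U * P * V * V' = U * P := by
  ext1 j b
  obtain ⟨j', q, hq⟩ := h j
  rw [hq, Matrix.mul_apply, mul_row_eq_single hV hq]
  simp [Pi.single_apply]

theorem blockDiagonal'_mul_apply {ι R A : Type*} [Fintype ι] [DecidableEq ι]
    [NonUnitalNonAssocSemiring R] {m n : ι → Type*} [∀ i, Fintype (n i)]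
    (P : ∀ i, Matrix (m i) (n i) R) (Q : Matrix (Σ i, n i) A R) (i : ι) (j : m i) (a : A) :
    (blockDiagonal' P * Q) ⟨i, j⟩ a = (P i * Q.submatrix (Sigma.mk i) id) j a := by
  rw [Matrix.mul_apply, Fintype.sum_sigma, Finset.sum_eq_single i]
  · simp only [blockDiagonal'_apply_eq, Matrix.mul_apply, submatrix_apply, id]
  · intro i' _ hi'
    exact Finset.sum_eq_zero fun l _ => by rw [blockDiagonal'_apply_ne _ _ _ hi'.symm, zero_mul]
  · simp

theorem submatrix_sigma_mul {ι R A : Type*} [DecidableEq ι] [Fintype A] [Semiring R]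
    {n : ι → Type*} [∀ i, DecidableEq (n i)] {P : Matrix (Σ i, n i) A R}
    {Q : Matrix A (Σ i, n i) R} (h : P * Q = 1) (i : ι) :
    P.submatrix (Sigma.mk i) id * Q.submatrix id (Sigma.mk i) = 1 := by
  ext j l
  have h1 := congrFun (congrFun h ⟨i, j⟩) ⟨i, l⟩
  rw [Matrix.mul_apply] at h1
  rw [Matrix.mul_apply]
  simp only [submatrix_apply, id, h1]
  by_cases hjl : j = l
  · subst hjl; simp
  · rw [one_apply_ne hjl, one_apply_ne]
    intro he
    exact hjl (by simpa using he)

theorem map_C_mul_map_C {m n : Type*} [Fintype n] [DecidableEq m] {P : Matrix m n ℝ}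
    {Q : Matrix n m ℝ} (h : P * Q = 1) : P.map C * Q.map C = (1 : Matrix m m ℝ[X]) := by
  rw [← Matrix.map_mul, h, Matrix.map_one _ C_0 C_1]

theorem susy_of_intertwine {N : ℕ} {m n A A' : Type*} [Fintype A] [DecidableEq A] [Fintype A']
    [Fintype m] [DecidableEq m] [Fintype n] {L : Fin N → Matrix A A' ℝ[X]}
    {R : Fin N → Matrix A' A ℝ[X]} {L' : Fin N → Matrix m n ℝ[X]} {R' : Fin N → Matrix n m ℝ[X]}
    {U' : Matrix m A ℝ[X]} {U : Matrix A m ℝ[X]} {V' : Matrix n A' ℝ[X]} (hU : U' * U = 1)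
    (hL : ∀ I, L' I * V' = U' * L I) (hR : ∀ I, R' I * U' = V' * R I) {I J : Fin N} {q : ℝ[X]}
    (h : L I * R J + L J * R I = q • (1 : Matrix A A ℝ[X])) :
    L' I * R' J + L' J * R' I = q • (1 : Matrix m m ℝ[X]) := by
  have key : ∀ I J, L' I * R' J = U' * (L I * R J) * U := by
    intro I J
    calc L' I * R' J = L' I * R' J * (U' * U) := by rw [hU, Matrix.mul_one]
      _ = L' I * (R' J * U') * U := by simp only [Matrix.mul_assoc]
      _ = (L' I * V') * R J * U := by rw [hR]; simp only [Matrix.mul_assoc]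
      _ = _ := by rw [hL]; simp only [Matrix.mul_assoc]
  rw [key, key, ← Matrix.add_mul, ← Matrix.mul_add, h, Matrix.mul_smul, Matrix.smul_mul,
    Matrix.mul_one, hU]

variable {N : ℕ} {B F : Type*} [Fintype B] [DecidableEq B] [Fintype F] [DecidableEq F]

/-- A supermultiplet whose engineering dimensions lie in a half-open unit interval is equivalent to
a direct sum of minimal valise Adinkras. -/
theorem EngSupermultiplet.exists_equivalent_directSum (M : EngSupermultiplet N B F) {T : ℝ}
    (hB : ∀ a, T - 1 ≤ M.dimB a ∧ M.dimB a < T) (hF : ∀ α, T - 1 ≤ M.dimF α ∧ M.dimF α < T) :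
    ∃ (k : ℕ) (b f : Fin k → ℕ) (A : ∀ i : Fin k, EngSupermultiplet N (Fin (b i)) (Fin (f i))),
      (∀ i, (A i).IsMinimalValiseAdinkra) ∧ LocallyEquivalent M (directSum A) := by
  -- The same `H`, depending only on `N`, determines the size of every summand and the lower bound
  -- on all competing supermultiplets.
  obtain ⟨H, hP, hH, hmax⟩ := exists_maximal_subgroup (none : Option (Fin N))
  obtain ⟨k, p, f, t, x, u, y, v, h1, h2, h3, h4, hcard, hx, hy, hedge⟩ :=
    M.exists_monomial_frame hB hF hP hH hmax
  have ht : ∀ i, Fin (p i) → T - 1 ≤ t i ∧ t i < T := by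
    intro i j
    have h5 := congrFun (congrFun h1 ⟨i, j⟩) ⟨i, j⟩
    rw [one_apply_eq, Matrix.mul_apply] at h5
    obtain ⟨a, -, ha⟩ := Finset.exists_ne_zero_of_sum_ne_zero (h5.trans_ne one_ne_zero)
    rw [← hx ⟨i, j⟩ a (left_ne_zero_of_mul ha)]
    exact hB a
  let U' : ∀ i, Matrix (Fin (p i)) B ℝ[X] := fun i =>
    (x.map C).submatrix (Sigma.mk (β := fun i => Fin (p i)) i) id
  let U : ∀ i, Matrix B (Fin (p i)) ℝ[X] := fun i =>
    (u.map C).submatrix id (Sigma.mk (β := fun i => Fin (p i)) i)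
  let V' : ∀ i, Matrix (Fin (f i)) F ℝ[X] := fun i =>
    (y.map C).submatrix (Sigma.mk (β := fun i => Fin (f i)) i) id
  let V : ∀ i, Matrix F (Fin (f i)) ℝ[X] := fun i =>
    (v.map C).submatrix id (Sigma.mk (β := fun i => Fin (f i)) i)
  have hUU : ∀ i, U' i * U i = 1 := submatrix_sigma_mul (map_C_mul_map_C h1)
  have hVV : ∀ i, V' i * V i = 1 := submatrix_sigma_mul (map_C_mul_map_C h3)
  have hrowL : ∀ {I i j j' s}, x ⟨i, j⟩ ᵥ* (M.L I).map (evalRingHom 1) = s • y ⟨i, j'⟩ →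
      ∀ α, (U' i * M.L I) j α = C s * X ^ partnerExp T (t i) * V' i j' α := by
    intro I i j j' s h α
    exact sum_monomial_rows (fun a α n hn =>
      (eq_partnerDim (hB a).2 (hF α).1 (hF α).2 (M.homog_L I a α n hn)).2) (hx ⟨i, j⟩) h α
  have hrowR : ∀ {I i j j' s}, y ⟨i, j'⟩ ᵥ* (M.R I).map (evalRingHom 1) = s • x ⟨i, j⟩ →
      ∀ a, (V' i * M.R I) j' a = C s * X ^ (1 - partnerExp T (t i)) * U' i j a := by
    intro I i j j' s h a
    rw [← partnerExp_partnerDim (ht i j).1 (ht i j).2]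
    exact sum_monomial_rows (fun α a n hn =>
      (eq_partnerDim (hF α).2 (hB a).1 (hB a).2 (M.homog_R I α a n hn)).2) (hy ⟨i, j'⟩) h a
  let L : ∀ i, Fin N → Matrix (Fin (p i)) (Fin (f i)) ℝ[X] := fun i I => U' i * M.L I * V i
  let R : ∀ i, Fin N → Matrix (Fin (f i)) (Fin (p i)) ℝ[X] := fun i I => V' i * M.R I * U i
  have hL : ∀ i I, L i I * V' i = U' i * M.L I := by
    intro i I
    refine mul_row_intertwine (hVV i) fun j => ?_
    obtain ⟨j', s, -, h, -⟩ := (hedge I i).1 j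
    exact ⟨j', _, hrowL h⟩
  have hR : ∀ i I, R i I * U' i = V' i * M.R I := by
    intro i I
    refine mul_row_intertwine (hUU i) fun j' => ?_
    obtain ⟨j, s, -, -, h⟩ := (hedge I i).2 j'
    exact ⟨j, _, hrowR h⟩
  obtain ⟨A, hAL, hAR, hAB, hAF⟩ : ∃ A : ∀ i, EngSupermultiplet N (Fin (p i)) (Fin (f i)),
      (∀ i, (A i).L = L i) ∧ (∀ i, (A i).R = R i) ∧ (∀ i j, (A i).dimB j = t i) ∧
      ∀ i j, (A i).dimF j = partnerDim T (t i) := by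
    refine ⟨fun i =>
      { L := L i
        R := R i
        susy_boson := fun I J => susy_of_intertwine (hUU i) (hL i) (hR i) (M.susy_boson I J)
        susy_fermion := fun I J => susy_of_intertwine (hVV i) (hR i) (hL i) (M.susy_fermion I J)
        dimB := fun _ => t i
        dimF := fun _ => partnerDim T (t i)
        homog_L := fun I j l n hn => by
          obtain ⟨j', s, -, h, -⟩ := (hedge I i).1 j
          rw [show L i I j l = _ from congrFun (mul_row_eq_single (hVV i) (hrowL h)) l,
            Pi.single_apply] at hn
          split_ifs at hn
          · rw [coeff_C_mul, coeff_X_pow] at hn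
            have hne : n = partnerExp T (t i) := by
              by_contra hne
              simp [hne] at hn
            rw [hne, add_half_eq_partnerDim]
          · simp at hn
        homog_R := fun I j' l n hn => by
          obtain ⟨j, s, -, -, h⟩ := (hedge I i).2 j'
          rw [show R i I j' l = _ from congrFun (mul_row_eq_single (hUU i) (hrowR h)) l,
            Pi.single_apply] at hn
          split_ifs at hn
          · rw [coeff_C_mul, coeff_X_pow] at hn
            have hne : n = 1 - partnerExp T (t i) := by
              by_contra hne
              simp [hne] at hn
            rw [hne, partnerDim_add_half]
          · simp at hn }, fun _ => rfl, fun _ => rfl, fun _ _ => rfl, fun _ _ => rfl⟩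
  have hedgeA : ∀ I i j j' s, x ⟨i, j⟩ ᵥ* (M.L I).map (evalRingHom 1) = s • y ⟨i, j'⟩ →
      y ⟨i, j'⟩ ᵥ* (M.R I).map (evalRingHom 1) = s • x ⟨i, j⟩ → ∃ e : ℕ, e ≤ 1 ∧
        (A i).L I j = Pi.single j' (C s * X ^ e) ∧
        (A i).R I j' = Pi.single j (C s * X ^ (1 - e)) := fun I i j j' s hl hr =>
    ⟨partnerExp T (t i), partnerExp_le_one T _,
      by rw [hAL]; exact mul_row_eq_single (hVV i) (hrowL hl),
      by rw [hAR]; exact mul_row_eq_single (hUU i) (hrowR hr)⟩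
  refine ⟨k, p, f, A, fun i => ⟨fun I => ⟨fun j => ?_, fun j' => ?_⟩, ⟨t i, hAB i, ?_⟩,
    ?_, fun b' f' M' h0 => ?_⟩, LocallyEquivalent.symm ?_⟩
  · obtain ⟨j', s, hs, hl, hr⟩ := (hedge I i).1 j
    exact ⟨j', s, hs, hedgeA I i j j' s hl hr⟩
  · obtain ⟨j, s, hs, hl, hr⟩ := (hedge I i).2 j'
    exact ⟨j, s, hs, hedgeA I i j j' s hl hr⟩
  · by_cases h : t i + 1 / 2 < T
    · exact Or.inl fun j => (hAF i j).trans (if_pos h)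
    · exact Or.inr fun j => (hAF i j).trans (if_neg h)
  · rw [Fintype.card_fin, Fintype.card_fin, hcard]
    exact Nat.card_pos
  · rw [Fintype.card_fin, Fintype.card_fin, hcard]
    simpa using M'.card_quotient_le hP hH hmax (by simpa using h0)
  have hLd : ∀ I, (directSum A).L I * y.map C = x.map C * M.L I := by
    intro I
    ext1 ⟨i, j⟩ α
    change (blockDiagonal' (fun i => (A i).L I) * y.map C) ⟨i, j⟩ α = _
    rw [blockDiagonal'_mul_apply, hAL]
    exact congrFun (congrFun (hL i I) j) α
  have hC : ∀ {z : ℝ} {n : ℕ}, (C z).coeff n ≠ 0 → n = 0 ∧ z ≠ 0 := by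
    intro z n hn
    rw [coeff_C] at hn
    split_ifs at hn with h0
    · exact ⟨h0, hn⟩
    · exact absurd rfl hn
  refine ⟨x.map C, u.map C, y.map C, v.map C, map_C_mul_map_C h1, map_C_mul_map_C h2,
    map_C_mul_map_C h3, map_C_mul_map_C h4, hLd,
    fun I => (directSum A).toSupermultiplet.R_mul_eq_of_L_mul_eq M.toSupermultiplet (hLd I),
    fun j a n hn => ?_, fun a j n hn => ?_, fun j α n hn => ?_, fun α j n hn => ?_⟩
  all_goals
    obtain ⟨rfl, hz⟩ := hC hn
    rw [Nat.cast_zero, add_zero]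
  · exact (hAB j.1 j.2).trans (hx j a hz).symm
  · exact (graded_inverse h1 h2 (d := fun j => t j.1) hx a j hz).trans (hAB j.1 j.2).symm
  · exact (hAF j.1 j.2).trans (hy j α hz).symm
  · exact (graded_inverse h3 h4 (d := fun j => partnerDim T (t j.1)) hy α j hz).trans
      (hAF j.1 j.2).symm

end Valises

/-! ### Induction on the depth below `T` -/

section Synthesis

variable {N : ℕ} {B F : Type*} [Fintype B] [DecidableEq B] [Fintype F] [DecidableEq F]

/-- The total distance, in rounded-up units, of the engineering dimensions below `T`. -/
noncomputable def EngSupermultiplet.depth (M : EngSupermultiplet N B F) (T : ℝ) : ℕ :=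
  ∑ a, ⌈T - M.dimB a⌉₊ + ∑ α, ⌈T - M.dimF α⌉₊

/-- Since `T - (d a₀ + 1)` is still nonnegative, truncation at zero does not interfere and the
ceiling at `a₀` drops by exactly one. -/
theorem sum_ceil_update_lt {A : Type*} [Fintype A] [DecidableEq A] {d : A → ℝ} {T : ℝ} {a₀ : A}
    (h : d a₀ < T - 1) :
    ∑ a, ⌈T - Function.update d a₀ (d a₀ + 1) a⌉₊ < ∑ a, ⌈T - d a⌉₊ := by
  have key : ⌈T - d a₀⌉₊ = ⌈T - (d a₀ + 1)⌉₊ + 1 := by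
    rw [← Nat.ceil_add_one (by linarith)]
    congr 1
    ring
  refine Finset.sum_lt_sum (fun a _ => ?_) ⟨a₀, Finset.mem_univ _, ?_⟩
  · by_cases ha : a = a₀
    · subst ha
      rw [Function.update_self, key]
      exact Nat.le_succ _
    · rw [Function.update_of_ne ha]
  · rw [Function.update_self, key]
    exact Nat.lt_succ_self _

theorem update_add_one_lt {A : Type*} [DecidableEq A] {d : A → ℝ} {T : ℝ} {a₀ : A}
    (hd : ∀ a, d a < T) (h : d a₀ < T - 1) (a : A) :
    Function.update d a₀ (d a₀ + 1) a < T := by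
  by_cases ha : a = a₀
  · subst ha
    rw [Function.update_self]
    linarith
  · rw [Function.update_of_ne ha]
    exact hd a

/-- Each raising decreases the depth and keeps all dimensions below `T`. Lowerings are appended as
the recursion unwinds, in the reverse order of the raisings. -/
theorem EngSupermultiplet.exists_synthesis {T : ℝ} (M : EngSupermultiplet N B F)
    (hB : ∀ a, M.dimB a < T) (hF : ∀ α, M.dimF α < T) :
    ∃ (k : ℕ) (b f : Fin k → ℕ) (A : ∀ i : Fin k, EngSupermultiplet N (Fin (b i)) (Fin (f i)))
      (M' : EngSupermultiplet N (Σ i, Fin (b i)) (Σ i, Fin (f i))),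
      (∀ i, (A i).IsMinimalValiseAdinkra) ∧
      Relation.ReflTransGen Lowers (directSum A) M' ∧ LocallyEquivalent M M' := by
  induction hn : M.depth T using Nat.strong_induction_on generalizing M with
  | _ n ih =>
  subst hn
  by_cases hlow : ∀ z, T - 1 ≤ Sum.elim M.dimB M.dimF z
  · obtain ⟨k, b, f, A, hA, hM⟩ := M.exists_equivalent_directSum
      (fun a => ⟨hlow (.inl a), hB a⟩) (fun α => ⟨hlow (.inr α), hF α⟩)
    exact ⟨k, b, f, A, _, hA, .refl, hM⟩
  push Not at hlow
  obtain ⟨z₁, hz₁⟩ := hlow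
  have : Nonempty (B ⊕ F) := ⟨z₁⟩
  -- The field of least dimension among all bosons and fermions has nothing `1/2` below it, so it
  -- can be raised.
  obtain ⟨z, hz⟩ := Finite.exists_min (Sum.elim M.dimB M.dimF)
  have hzT := (hz z₁).trans_lt hz₁
  rcases z with a₀ | α₀
  · simp only [Sum.elim_inl] at hz hzT
    obtain ⟨M₁, h1, h2, h3⟩ := M.exists_raise a₀ fun α h => by
      have := hz (.inr α)
      simp only [Sum.elim_inr] at this
      linarith
    obtain ⟨k, b, f, A, M', hA, hc, hM⟩ := ih (M₁.depth T)
      (by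
        rw [depth, depth, h1, h2]
        exact Nat.add_lt_add_right (sum_ceil_update_lt hzT) _)
      M₁ (by rw [h1]; exact update_add_one_lt hB hzT) (by rw [h2]; exact hF) rfl
    obtain ⟨A₀, hl, hM₀⟩ := exists_lowersBoson_of_raise h1 h2 h3 hM
    exact ⟨k, b, f, A, A₀, hA, hc.tail (Or.inl hl), hM₀⟩
  · simp only [Sum.elim_inr] at hz hzT
    obtain ⟨M₁, h1, h2, h3⟩ := M.swap.exists_raise α₀ fun a h => by
      have := hz (.inl a)
      simp only [Sum.elim_inl] at this
      simp only [swap] at h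
      linarith
    obtain ⟨k, b, f, A, M', hA, hc, hM⟩ := ih (M₁.swap.depth T)
      (by
        simp only [depth, swap, h1, h2]
        exact Nat.add_lt_add_left (sum_ceil_update_lt hzT) _)
      M₁.swap (fun a => by simpa [swap, h2] using hB a)
      (fun α => by
        simp only [swap, h1]
        exact update_add_one_lt hF hzT α) rfl
    obtain ⟨A₀, hl, hM₀⟩ := exists_lowersBoson_of_raise h1 h2 h3 hM.swap
    exact ⟨k, b, f, A, A₀.swap, hA, hc.tail (Or.inr hl), hM₀.swap⟩

end Synthesis

end Worldline

theorem mainTheorem1 {N : ℕ} {B F : Type*}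
    [Fintype B] [DecidableEq B] [Fintype F] [DecidableEq F]
    (M : Worldline.EngSupermultiplet N B F) :
    ∃ (k : ℕ) (b f : Fin k → ℕ)
      (A : ∀ i : Fin k, Worldline.EngSupermultiplet N (Fin (b i)) (Fin (f i)))
      (M' : Worldline.EngSupermultiplet N (Σ i, Fin (b i)) (Σ i, Fin (f i))),
      (∀ i, (A i).IsMinimalValiseAdinkra) ∧
      Relation.ReflTransGen Worldline.Lowers (Worldline.directSum A) M' ∧
      Worldline.LocallyEquivalent M M' := by
  obtain ⟨T, hT⟩ := (Set.finite_range (Sum.elim M.dimB M.dimF)).bddAbove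
  exact M.exists_synthesis (T := T + 1)
    (fun a => (hT ⟨.inl a, rfl⟩).trans_lt (lt_add_one T))
    (fun α => (hT ⟨.inr α, rfl⟩).trans_lt (lt_add_one T))
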